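/- Let $(M,g)$ be a (second countable, Hausdorff, smooth) Riemannian $N$-dimensional manifold, for instance a complete one, with volume measure $v_g$ and gradient $\nabla$. Let $\Omega\subset M$ be open and $p>1$. Let $W^{1,q}_{loc}(\Omega)$ ($q\ge 1$) consist of the functions which, on every open $U$ with compact closure $\overline U\subset\Omega$, belong to the completion of $\{\varphi\in C^\infty(U): \varphi,|\nabla\varphi|\in L^q(U)\}$ in the norm $\left(\int_U|\varphi|^q\,dv_g+\int_U|\nabla\varphi|^q\,dv_g\right)^{1/q}$, and let $C^1_0(\Omega)$ be the space of $C^1$ functions with compact support in $\Omega$. Let $\rho\in W^{1,p}_{loc}(\Omega)$ be nonnegative and $p$-superharmonic on $\Omega$ in the weak sense, that is $$\int_\Omega |\nabla\rho|^{p-2}\,(\nabla\rho\cdot\nabla\varphi)\,dv_g\ge 0\qquad\text{for all } \varphi\in C^1_0(\Omega),\ \varphi\ge 0 .$$ Let $s>0$, $a>1$ and $a'=\frac{a}{a-1}$. Then for every $u\in C^1_0(\Omega)$ $$\int_\Omega |u|^s\,dv_g\le\left(\frac{p}{p-1}\right)^{p/a}\left(\int_\Omega|\nabla u|^p\,dv_g\right)^{1/a}\left(\int_{\{x\in\Omega:\,u(x)\ne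 0\}}|u|^{\frac{as-p}{a-1}}\,\frac{\rho^{p(a'-1)}}{|\nabla\rho|^{p(a'-1)}}\,dv_g\right)^{1/a'},$$ provided that the right-hand side is not of the form $0\cdot\infty$. Here integrals take values in $[0,\infty]$, and the weight $\rho^{p(a'-1)}/|\nabla\rho|^{p(a'-1)}=\left(|\nabla\rho|/\rho\right)^{-p(a'-1)}$ is $+\infty$ wherever $\nabla\rho=0$. In particular, if $\rho=d^\alpha$ a.e. in $\Omega$ for some real $\alpha\ne 0$ and some nonnegative $d\in W^{1,1}_{loc}(\Omega)$ with $|\nabla d|=1$ a.e. in $\Omega$, then for every $u\in C^1_0(\Omega)$ $$\int_\Omega |u|^s\,dv_g\le\left(\frac{p}{|\alpha|(p-1)}\right)^{p/a}\left(\int_\Omega|\nabla u|^p\,dv_g\right)^{1/a}\left(\int_{\{x\in\Omega:\,u(x)\ne 0\}}|u|^{\frac{as-p}{a-1}}\,d^{\,p(a'-1)}\,dv_g\right)^{1/a'}.$$ -/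

import Mathlib

open Bundle MeasureTheory Filter Topology Set
open scoped Manifold ContDiff ENNReal

noncomputable section

namespace RiemannianHardy

section Volume

variable {N : ℕ} {M : Type*} [TopologicalSpace M] [ChartedSpace (EuclideanSpace ℝ (Fin N)) M]
  [RiemannianBundle (fun x : M ↦ TangentSpace (𝓡 N) x)]

/-- The coordinate vector field `∂ᵢ` of the chart around `c`, at the point with coordinates `y`. -/
def coordVec (c : M) (i : Fin N) (y : EuclideanSpace ℝ (Fin N)) :
    TangentSpace (𝓡 N) ((chartAt (EuclideanSpace ℝ (Fin N)) c).symm y) :=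
  mfderiv (𝓡 N) (𝓡 N) (chartAt (EuclideanSpace ℝ (Fin N)) c).symm y
    (EuclideanSpace.single i (1 : ℝ) : EuclideanSpace ℝ (Fin N))

/-- The Gram matrix `g_ij = g(∂ᵢ, ∂ⱼ)` of the metric in the chart around `c`. -/
def gramMatrix (c : M) (y : EuclideanSpace ℝ (Fin N)) : Matrix (Fin N) (Fin N) ℝ :=
  Matrix.of fun i j ↦ inner ℝ (coordVec c i y) (coordVec c j y)

variable [MeasurableSpace M]

/-- The measure `√det(g_ij) dy` of the chart around `c`, as a measure on `M` that lives on the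
domain of the chart. -/
def chartVolume (c : M) : Measure M :=
  ((volume.restrict (chartAt (EuclideanSpace ℝ (Fin N)) c).target).withDensity
    (fun y ↦ ENNReal.ofReal (Real.sqrt (gramMatrix c y).det))).map
      (chartAt (EuclideanSpace ℝ (Fin N)) c).symm

variable (N M) in
/-- The Riemannian volume measure: the least measure on `M` that dominates all the measures
`√det(g_ij) dy` of the charts. As these agree on the overlaps of the charts (change of variables),
this is the measure obtained by gluing them together. -/
def riemannianVolume : Measure M := ⨆ c : M, chartVolume (N := N) c

end Volume

section Sobolev

variable {N : ℕ} {M : Type*} [TopologicalSpace M] [ChartedSpace (EuclideanSpace ℝ (Fin N)) M]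
  [RiemannianBundle (fun x : M ↦ TangentSpace (𝓡 N) x)]

instance finiteDimensional_tangentSpace (x : M) : FiniteDimensional ℝ (TangentSpace (𝓡 N) x) :=
  inferInstanceAs (FiniteDimensional ℝ (EuclideanSpace ℝ (Fin N)))

instance completeSpace_tangentSpace (x : M) : CompleteSpace (TangentSpace (𝓡 N) x) :=
  FiniteDimensional.complete ℝ _

/-- The Riemannian gradient of a function: `g(∇u(x), v) = du(x) v` for all tangent vectors `v`. -/
def grad (u : M → ℝ) (x : M) : TangentSpace (𝓡 N) x :=
  (InnerProductSpace.toDual ℝ (TangentSpace (𝓡 N) x)).symm (mfderiv (𝓡 N) 𝓘(ℝ, ℝ) u x)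

variable (N) in
/-- The class `C¹₀(Ω)`: `C¹` functions with compact support contained in `Ω`. -/
structure IsC1Compact (Ω : Set M) (u : M → ℝ) : Prop where
  contMDiff : ContMDiff (𝓡 N) 𝓘(ℝ, ℝ) 1 u
  hasCompactSupport : HasCompactSupport u
  tsupport_subset : tsupport u ⊆ Ω

variable [MeasurableSpace M]

/-- A vector field is (a.e.) measurable on `U`: its components in every chart are. -/
def AEMeasurableField (U : Set M) (G : ∀ x : M, TangentSpace (𝓡 N) x) : Prop :=
  ∀ c : M, AEMeasurable
    (fun x ↦ (mfderiv (𝓡 N) (𝓡 N) (chartAt (EuclideanSpace ℝ (Fin N)) c) x (G x) :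
      EuclideanSpace ℝ (Fin N)))
    ((riemannianVolume N M).restrict (U ∩ (chartAt (EuclideanSpace ℝ (Fin N)) c).source))

/-- `f ∈ W^{1,q}(U)` with gradient `G`, where `W^{1,q}(U)` is the completion of
`{φ ∈ C^∞(U) : φ, |∇φ| ∈ L^q(U)}` in the norm `(∫_U |φ|^q + ∫_U |∇φ|^q)^{1/q}`. -/
structure HasSobolevGradOn (q : ℝ) (U : Set M) (f : M → ℝ)
    (G : ∀ x : M, TangentSpace (𝓡 N) x) : Prop where
  aemeasurable : AEMeasurable f ((riemannianVolume N M).restrict U)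
  aemeasurable_grad : AEMeasurableField U G
  exists_approx : ∃ φ : ℕ → M → ℝ,
    (∀ n, ContMDiffOn (𝓡 N) 𝓘(ℝ, ℝ) ∞ (φ n) U ∧
      ∫⁻ x in U, ‖φ n x‖ₑ ^ q ∂(riemannianVolume N M) < ⊤ ∧
      ∫⁻ x in U, ‖grad (N := N) (φ n) x‖ₑ ^ q ∂(riemannianVolume N M) < ⊤) ∧
    Tendsto (fun n ↦ ∫⁻ x in U, ‖φ n x - f x‖ₑ ^ q ∂(riemannianVolume N M)) atTop (𝓝 0) ∧
    Tendsto (fun n ↦ ∫⁻ x in U, ‖grad (N := N) (φ n) x - G x‖ₑ ^ q ∂(riemannianVolume N M))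
      atTop (𝓝 0)

/-- `f ∈ W^{1,q}_loc(Ω)` with gradient `G`: this holds on all relatively compact open `U ⋐ Ω`. -/
def HasSobolevGradLoc (q : ℝ) (Ω : Set M) (f : M → ℝ)
    (G : ∀ x : M, TangentSpace (𝓡 N) x) : Prop :=
  ∀ U : Set M, IsOpen U → IsCompact (closure U) → closure U ⊆ Ω → HasSobolevGradOn q U f G

/-- `f`, with gradient `G`, is `p`-superharmonic on `Ω` in the weak sense:
`f ∈ L¹_loc(Ω)`, `|∇f| ∈ L^{p-1}_loc(Ω)` and `-Δ_p f ≥ 0` against nonnegative test functions. -/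
structure IsPSuperharmonic (p : ℝ) (Ω : Set M) (f : M → ℝ)
    (G : ∀ x : M, TangentSpace (𝓡 N) x) : Prop where
  locallyIntegrable : LocallyIntegrableOn f Ω (riemannianVolume N M)
  grad_locallyIntegrable : ∀ K : Set M, IsCompact K → K ⊆ Ω →
    ∫⁻ x in K, ‖G x‖ₑ ^ (p - 1) ∂(riemannianVolume N M) < ⊤
  integral_nonneg : ∀ φ : M → ℝ, IsC1Compact N Ω φ → (∀ x, 0 ≤ φ x) →
    0 ≤ ∫ x in Ω, ‖G x‖ ^ (p - 2) * inner ℝ (G x) (grad (N := N) φ x) ∂(riemannianVolume N M)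

/-- The quotient `f / |∇f|` in `[0, ∞]`, read as the reciprocal of `|∇f| / f`. It is `∞` wherever
`∇f = 0`, including points where `f = 0` too, as `|∇f| / f` is read as `0` there. -/
def weightQuotient (f : M → ℝ) (G : ∀ x : M, TangentSpace (𝓡 N) x) (x : M) : ℝ≥0∞ :=
  (‖G x‖ₑ / ENNReal.ofReal (f x))⁻¹

end Sobolev

end RiemannianHardy

end

open RiemannianHardy

set_option linter.unusedSectionVars false

namespace RiemannianHardy

local notation "𝔼" N:max => EuclideanSpace ℝ (Fin N)

/-! The inequality interpolates, by Hölder, a Hardy inequality for `ρ`. Put w = |∇ρ|/ρ.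

Hardy inequality (`IsPSuperharmonic.lintegral_hardy`). Formally, testing superharmonicity with |u|^p
(ρ+ε)^(1-p) and writing X = |u||∇ρ|/(ρ+ε) gives (p-1) ∫ X^p ≤ p ∫ X^(p-1) |∇u|. Hölder bounds the
right side by p (∫ X^p)^(1-1/p) (∫ |∇u|^p)^(1/p). Since ∫ X^p is finite for ε > 0, it can be
absorbed, and Fatou as ε → 0 yields ∫ (|u| w)^p ≤ (p/(p-1))^p ∫ |∇u|^p.

Interpolation (`lintegral_rpow_le_of_weighted`). Hölder with exponents a, a' is applied to |u|^s =
(|u| w)^(p/a) · |u|^(s-p/a) w^(-p/a).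

The test function above is not C¹, because ρ is only Sobolev. It is built instead from smooth
approximants φₙ of ρ, which may be negative, so t ↦ (t+ε)^(1-p) is replaced by the bounded
nonnegative C¹ function `negPowCut`; `integral_limit_nonneg` then lets n → ∞.

Two pointwise facts on Sobolev gradients are needed: ∇ρ = 0 a.e. on {ρ = 0}, so that w is finite
a.e., and ∇ρ/ρ = α ∇d/d when ρ = d^α, so that w = |α|/d. Both follow in charts from the weak chain
rule `integral_chain_mul_eq_neg` and the fundamental lemma of the calculus of variations. In the
second case w > 0, so ∫ |∇u|^p = 0 forces u = 0 a.e. by Hardy, and the form 0·∞ need not be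
excluded.

About the volume, only two things matter: null sets can be read in charts, and on compact subsets of
a chart Lebesgue measure is dominated by a multiple of it. -/

theorem isOpen_target_inter_preimage {N : ℕ} {M : Type*} [TopologicalSpace M]
    [ChartedSpace (𝔼 N) M] {U : Set M} (hU : IsOpen U) (c : M) :
    IsOpen ((chartAt (𝔼 N) c).target ∩ (chartAt (𝔼 N) c).symm ⁻¹' U) :=
  (chartAt (𝔼 N) c).symm.isOpen_inter_preimage hU

/-! ### Tangent vectors, gradients and the metric in coordinates. -/

section Charts

variable {N : ℕ} {M : Type*} [TopologicalSpace M] [ChartedSpace (𝔼 N) M]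
  [IsManifold (𝓡 N) ∞ M]

omit [IsManifold (𝓡 N) ∞ M] in
theorem exists_target_symm_eq {c x : M} (hx : x ∈ (chartAt (𝔼 N) c).source) :
    ∃ y ∈ (chartAt (𝔼 N) c).target, (chartAt (𝔼 N) c).symm y = x :=
  ⟨chartAt (𝔼 N) c x, (chartAt (𝔼 N) c).map_source hx, (chartAt (𝔼 N) c).left_inv hx⟩

theorem mdifferentiable_chartAt (c : M) :
    (chartAt (𝔼 N) c).MDifferentiable (𝓡 N) (𝓡 N) :=
  have : IsManifold (𝓡 N) 1 M := IsManifold.of_le (n := ∞) (by exact_mod_cast le_top)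
  mdifferentiable_chart c

theorem contDiffOn_comp_chart_symm {n : ℕ∞ω} (hn : n ≤ (∞ : ℕ∞ω)) {U : Set M} {u : M → ℝ}
    (hu : ContMDiffOn (𝓡 N) 𝓘(ℝ, ℝ) n u U) (c : M) :
    ContDiffOn ℝ n (fun z ↦ u ((chartAt (𝔼 N) c).symm z))
      ((chartAt (𝔼 N) c).target ∩ (chartAt (𝔼 N) c).symm ⁻¹' U) := by
  rw [← contMDiffOn_iff_contDiffOn]
  have : IsManifold (𝓡 N) n M := IsManifold.of_le hn
  have h1 : ContMDiffOn (𝓡 N) (𝓡 N) n (chartAt (𝔼 N) c).symm (chartAt (𝔼 N) c).target :=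
    contMDiffOn_chart_symm
  exact hu.comp (h1.mono inter_subset_left) inter_subset_right

theorem mfderiv_chart_symm_apply {c : M} {y : 𝔼 N}
    (hy : y ∈ (chartAt (𝔼 N) c).target) (w : 𝔼 N) :
    mfderiv (𝓡 N) (𝓡 N) (chartAt (𝔼 N) c) ((chartAt (𝔼 N) c).symm y)
      (mfderiv (𝓡 N) (𝓡 N) (chartAt (𝔼 N) c).symm y w) = w :=
  DFunLike.congr_fun ((mdifferentiable_chartAt c).comp_symm_deriv hy) w

theorem mfderiv_symm_chart_apply {c : M} {y : 𝔼 N}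
    (hy : y ∈ (chartAt (𝔼 N) c).target)
    (v : TangentSpace (𝓡 N) ((chartAt (𝔼 N) c).symm y)) :
    mfderiv (𝓡 N) (𝓡 N) (chartAt (𝔼 N) c).symm y
      (mfderiv (𝓡 N) (𝓡 N) (chartAt (𝔼 N) c) ((chartAt (𝔼 N) c).symm y) v) = v := by
  obtain ⟨w, rfl⟩ := (mdifferentiable_chartAt c).symm.mfderiv_surjective (x := y) hy v
  congr 1
  exact mfderiv_chart_symm_apply hy w

variable [RiemannianBundle (fun x : M ↦ TangentSpace (𝓡 N) x)]

/-- The components of a tangent vector at the point with coordinates `y` in the chart at `c`. -/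
noncomputable def coordComp (c : M) {y : 𝔼 N} (v : TangentSpace (𝓡 N) ((chartAt (𝔼 N) c).symm y)) :
    𝔼 N :=
  mfderiv (𝓡 N) (𝓡 N) (chartAt (𝔼 N) c) ((chartAt (𝔼 N) c).symm y) v

theorem sum_coordVec {c : M} {y : 𝔼 N} (w : 𝔼 N) :
    ∑ i, w i • coordVec c i y = mfderiv (𝓡 N) (𝓡 N) (chartAt (𝔼 N) c).symm y w := by
  have : w = ∑ i, w i • (EuclideanSpace.single i (1 : ℝ) : 𝔼 N) := by
    simpa using ((EuclideanSpace.basisFun (Fin N) ℝ).sum_repr w).symm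
  conv_rhs => rw [this]
  refine Eq.trans ?_ (map_sum (mfderiv (𝓡 N) (𝓡 N) (chartAt (𝔼 N) c).symm y)
    (fun i ↦ w i • (EuclideanSpace.single i (1 : ℝ) : 𝔼 N)) Finset.univ).symm
  refine Finset.sum_congr rfl fun i _ ↦ ?_
  exact (map_smul (mfderiv (𝓡 N) (𝓡 N) (chartAt (𝔼 N) c).symm y) (w i) _).symm

theorem sum_coordComp_smul_coordVec {c : M} {y : 𝔼 N}
    (hy : y ∈ (chartAt (𝔼 N) c).target)
    (v : TangentSpace (𝓡 N) ((chartAt (𝔼 N) c).symm y)) :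
    ∑ i, coordComp c v i • coordVec c i y = v := by
  rw [sum_coordVec]
  exact mfderiv_symm_chart_apply hy v

theorem linearIndependent_coordVec {c : M} {y : 𝔼 N}
    (hy : y ∈ (chartAt (𝔼 N) c).target) : LinearIndependent ℝ (fun i ↦ coordVec c i y) := by
  rw [Fintype.linearIndependent_iff]
  intro w hw i
  have h1 := sum_coordVec (c := c) (y := y) (WithLp.toLp 2 w)
  have h2 : mfderiv (𝓡 N) (𝓡 N) (chartAt (𝔼 N) c).symm y (WithLp.toLp 2 w) = 0 := by
    rw [← h1]; exact hw
  have h3 := mfderiv_chart_symm_apply hy (WithLp.toLp 2 w)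
  rw [h2, map_zero] at h3
  exact (congrArg (fun v : 𝔼 N ↦ v i) h3).symm

theorem gramMatrix_det_pos {c : M} {y : 𝔼 N}
    (hy : y ∈ (chartAt (𝔼 N) c).target) : 0 < (gramMatrix c y).det := by
  have h : gramMatrix c y = Matrix.gram ℝ (fun i ↦ coordVec c i y) := by
    ext i j
    rw [Matrix.gram_apply, gramMatrix, Matrix.of_apply]
  rw [h]
  have hp : (Matrix.gram ℝ (fun i ↦ coordVec c i y)).PosDef :=
    Matrix.posDef_gram_of_linearIndependent (linearIndependent_coordVec hy)
  exact hp.det_pos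

theorem inner_eq_sum_gramMatrix {c : M} {y : 𝔼 N}
    (hy : y ∈ (chartAt (𝔼 N) c).target)
    (v w : TangentSpace (𝓡 N) ((chartAt (𝔼 N) c).symm y)) :
    inner ℝ v w = ∑ i, ∑ j, coordComp c v i * coordComp c w j * gramMatrix c y i j := by
  conv_lhs => rw [← sum_coordComp_smul_coordVec hy v, ← sum_coordComp_smul_coordVec hy w]
  rw [sum_inner]
  refine Finset.sum_congr rfl fun i _ ↦ ?_
  rw [inner_sum]
  refine Finset.sum_congr rfl fun j _ ↦ ?_
  rw [real_inner_smul_left, real_inner_smul_right, gramMatrix, Matrix.of_apply, mul_assoc]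

theorem inner_coordVec_eq_sum {c : M} {y : 𝔼 N}
    (hy : y ∈ (chartAt (𝔼 N) c).target)
    (v : TangentSpace (𝓡 N) ((chartAt (𝔼 N) c).symm y)) (j : Fin N) :
    inner ℝ v (coordVec c j y) = ∑ i, coordComp c v i * gramMatrix c y i j := by
  conv_lhs => rw [← sum_coordComp_smul_coordVec hy v]
  simp [sum_inner, inner_smul_left, gramMatrix]

theorem eq_zero_of_inner_coordVec_eq_zero {c : M} {y : 𝔼 N}
    (hy : y ∈ (chartAt (𝔼 N) c).target)
    (v : TangentSpace (𝓡 N) ((chartAt (𝔼 N) c).symm y))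
    (h : ∀ i, inner ℝ v (coordVec c i y) = 0) : v = 0 := by
  have : inner ℝ v v = (0 : ℝ) := by
    nth_rw 2 [← sum_coordComp_smul_coordVec hy v]
    rw [inner_sum]
    simp [inner_smul_right, h]
  exact inner_self_eq_zero.1 this

theorem inner_grad (u : M → ℝ) (x : M) (v : TangentSpace (𝓡 N) x) :
    inner ℝ (grad (N := N) u x) v = mfderiv (𝓡 N) 𝓘(ℝ, ℝ) u x v :=
  InnerProductSpace.toDual_symm_apply

theorem inner_grad_coordVec {u : M → ℝ} {c : M} {y : 𝔼 N}
    (hy : y ∈ (chartAt (𝔼 N) c).target)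
    (hu : MDifferentiableAt (𝓡 N) 𝓘(ℝ, ℝ) u ((chartAt (𝔼 N) c).symm y)) (i : Fin N) :
    inner ℝ (grad (N := N) u ((chartAt (𝔼 N) c).symm y)) (coordVec c i y) =
      fderiv ℝ (fun z ↦ u ((chartAt (𝔼 N) c).symm z)) y (EuclideanSpace.single i 1) := by
  rw [inner_grad, ← mfderiv_eq_fderiv]
  have := mfderiv_comp y hu ((mdifferentiable_chartAt c).symm.mdifferentiableAt hy)
  exact (DFunLike.congr_fun this _).symm

variable [IsContMDiffRiemannianBundle (𝓡 N) ∞ (𝔼 N) (fun x : M ↦ TangentSpace (𝓡 N) x)]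

/-- Each ∂ᵢ is the tangent map of the inverse chart on a constant vector, hence a continuous section
of the tangent bundle, and the metric is continuous along continuous sections. -/
theorem continuousOn_gramMatrix_apply (c : M) (i j : Fin N) :
    ContinuousOn (fun y ↦ gramMatrix c y i j) (chartAt (𝔼 N) c).target := by
  have : IsManifold (𝓡 N) 1 M := IsManifold.of_le (n := ∞) (by exact_mod_cast le_top)
  have key (i : Fin N) : ContinuousOn (fun y ↦ (⟨(chartAt (𝔼 N) c).symm y, coordVec c i y⟩ :
      TotalSpace (𝔼 N) (fun x : M ↦ TangentSpace (𝓡 N) x))) (chartAt (𝔼 N) c).target := by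
    have h1 : ContMDiffOn (𝓡 N) (𝓡 N) 1 (chartAt (𝔼 N) c).symm (chartAt (𝔼 N) c).target :=
      contMDiffOn_chart_symm
    have h2 := h1.continuousOn_tangentMapWithin le_rfl
      (chartAt (𝔼 N) c).open_target.uniqueMDiffOn
    have h3 : Continuous (fun y : 𝔼 N ↦
      ((tangentBundleModelSpaceHomeomorph (𝓡 N)).symm (y, (EuclideanSpace.single i (1 : ℝ) : 𝔼 N))))
      := (Homeomorph.continuous _).comp (by fun_prop)
    have h4 := h2.comp h3.continuousOn (s := (chartAt (𝔼 N) c).target) (fun y hy ↦ hy)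
    refine h4.congr fun y hy ↦ ?_
    have h5 := mfderivWithin_of_isOpen (I := 𝓡 N) (I' := 𝓡 N)
      (f := (chartAt (𝔼 N) c).symm) (chartAt (𝔼 N) c).open_target hy
    unfold coordVec
    rw [← h5]
    rfl
  have : IsContinuousRiemannianBundle (𝔼 N) (fun x : M ↦ TangentSpace (𝓡 N) x) := by
    obtain ⟨g, hg, h⟩ := IsContMDiffRiemannianBundle.exists_contMDiff (IB := 𝓡 N) (n := ∞)
      (F := 𝔼 N) (E := fun x : M ↦ TangentSpace (𝓡 N) x)
    exact ⟨g, hg.continuous, h⟩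
  exact (key i).inner_bundle (key j)

end Charts

/-! ### Measurability of vector fields through their chart components. -/

section Measurability

variable {N : ℕ} {M : Type*} [TopologicalSpace M] [SecondCountableTopology M]
  [ChartedSpace (𝔼 N) M] [IsManifold (𝓡 N) ∞ M] [MeasurableSpace M] [BorelSpace M]

omit [IsManifold (𝓡 N) ∞ M] in
-- By second countability, countably many chart domains cover `M`.
theorem aemeasurable_restrict_of_charts {β : Type*} [MeasurableSpace β] {μ : Measure M}
    {U : Set M} {f : M → β}
    (h : ∀ c : M, AEMeasurable f (μ.restrict (U ∩ (chartAt (𝔼 N) c).source))) :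
    AEMeasurable f (μ.restrict U) := by
  obtain ⟨s, hs, hsU⟩ := TopologicalSpace.countable_cover_nhds
    (fun x : M ↦ (chartAt (𝔼 N) x).open_source.mem_nhds (mem_chart_source (𝔼 N) x))
  have := hs.to_subtype
  have hU : U = ⋃ c : s, U ∩ (chartAt (𝔼 N) (c : M)).source := by
    rw [← inter_iUnion, iUnion_subtype, hsU, inter_univ]
  rw [hU, aemeasurable_iUnion_iff]
  exact fun c ↦ h c

variable [RiemannianBundle (fun x : M ↦ TangentSpace (𝓡 N) x)]
  [IsContMDiffRiemannianBundle (𝓡 N) ∞ (𝔼 N) (fun x : M ↦ TangentSpace (𝓡 N) x)]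

theorem aemeasurable_comp_chart {μ : Measure M} {U : Set M} {c : M} {f : 𝔼 N → ℝ}
    (hf : ContinuousOn f (chartAt (𝔼 N) c).target) :
    AEMeasurable (fun x ↦ f (chartAt (𝔼 N) c x))
      (μ.restrict (U ∩ (chartAt (𝔼 N) c).source)) :=
  ((hf.comp (chartAt (𝔼 N) c).continuousOn (chartAt (𝔼 N) c).mapsTo).aemeasurable
    (chartAt (𝔼 N) c).open_source.measurableSet).mono_measure
    (Measure.restrict_mono inter_subset_right le_rfl)

/-- The components of a vector field in the chart at `c`. -/
noncomputable def fieldComp (c : M) (G : ∀ x : M, TangentSpace (𝓡 N) x) (x : M) : 𝔼 N :=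
  mfderiv (𝓡 N) (𝓡 N) (chartAt (𝔼 N) c) x (G x)

theorem AEMeasurableField.coord {U : Set M} {G : ∀ x : M, TangentSpace (𝓡 N) x}
    (hG : AEMeasurableField U G) (c : M) (i : Fin N) :
    AEMeasurable (fun x ↦ fieldComp c G x i)
      ((riemannianVolume N M).restrict (U ∩ (chartAt (𝔼 N) c).source)) :=
  (EuclideanSpace.proj (𝕜 := ℝ) (ι := Fin N) i).measurable.comp_aemeasurable (hG c)

theorem AEMeasurableField.inner {U : Set M} (hU : IsOpen U)
    {G H : ∀ x : M, TangentSpace (𝓡 N) x}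
    (hG : AEMeasurableField U G) (hH : AEMeasurableField U H) :
    AEMeasurable (fun x ↦ (inner ℝ (G x) (H x) : ℝ)) ((riemannianVolume N M).restrict U) := by
  refine aemeasurable_restrict_of_charts (N := N) fun c ↦ ?_
  have : AEMeasurable (fun x ↦ ∑ i, ∑ j,
      fieldComp c G x i *
      fieldComp c H x j *
      gramMatrix c (chartAt (𝔼 N) c x) i j)
      ((riemannianVolume N M).restrict (U ∩ (chartAt (𝔼 N) c).source)) := by
    refine Finset.aemeasurable_fun_sum _ fun i _ ↦ Finset.aemeasurable_fun_sum _ fun j _ ↦ ?_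
    exact ((hG.coord c i).mul (hH.coord c j)).mul
      (aemeasurable_comp_chart (N := N) (continuousOn_gramMatrix_apply (N := N) c i j))
  refine this.congr ?_
  filter_upwards [ae_restrict_mem (hU.inter (chartAt (𝔼 N) c).open_source).measurableSet]
    with x hx
  obtain ⟨y, hy, rfl⟩ := exists_target_symm_eq hx.2
  rw [(chartAt (𝔼 N) c).right_inv hy]
  exact (inner_eq_sum_gramMatrix hy (G _) (H _)).symm

theorem AEMeasurableField.norm {U : Set M} (hU : IsOpen U)
    {G : ∀ x : M, TangentSpace (𝓡 N) x} (hG : AEMeasurableField U G) :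
    AEMeasurable (fun x ↦ ‖G x‖) ((riemannianVolume N M).restrict U) := by
  simp_rw [norm_eq_sqrt_real_inner]
  exact (hG.inner hU hG).sqrt

theorem AEMeasurableField.enorm {U : Set M} (hU : IsOpen U)
    {G : ∀ x : M, TangentSpace (𝓡 N) x} (hG : AEMeasurableField U G) :
    AEMeasurable (fun x ↦ ‖G x‖ₑ) ((riemannianVolume N M).restrict U) := by
  simp_rw [← ofReal_norm]
  exact (hG.norm hU).ennreal_ofReal

omit [SecondCountableTopology M] [IsManifold (𝓡 N) ∞ M] [BorelSpace M]
  [IsContMDiffRiemannianBundle (𝓡 N) ∞ (𝔼 N) (fun x : M ↦ TangentSpace (𝓡 N) x)] in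
theorem AEMeasurableField.sub {U : Set M} {G H : ∀ x : M, TangentSpace (𝓡 N) x}
    (hG : AEMeasurableField U G) (hH : AEMeasurableField U H) :
    AEMeasurableField U (fun x ↦ G x - H x) := by
  intro c
  refine ((hG c).sub (hH c)).congr (.of_forall fun x ↦ ?_)
  exact (map_sub (mfderiv (𝓡 N) (𝓡 N) (chartAt (𝔼 N) c) x) (G x) (H x)).symm

/-- The classical formula (∇u)ⁱ = gⁱʲ ∂ⱼu, obtained by solving the linear system g(∇u, ∂ᵢ) = ∂ᵢu. -/
theorem coordComp_grad {u : M → ℝ} {c : M} {y : 𝔼 N}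
    (hy : y ∈ (chartAt (𝔼 N) c).target)
    (hu : MDifferentiableAt (𝓡 N) 𝓘(ℝ, ℝ) u ((chartAt (𝔼 N) c).symm y)) :
    coordComp c (grad (N := N) u ((chartAt (𝔼 N) c).symm y)) =
      WithLp.toLp 2 (Matrix.mulVec (gramMatrix c y)⁻¹ (fun i ↦
        fderiv ℝ (fun z ↦ u ((chartAt (𝔼 N) c).symm z)) y (EuclideanSpace.single i 1))) := by
  set w := coordComp c (grad (N := N) u ((chartAt (𝔼 N) c).symm y)) with hw
  have hdet : IsUnit (gramMatrix c y).det := (gramMatrix_det_pos (N := N) hy).ne'.isUnit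
  have h : Matrix.mulVec (gramMatrix c y) w.ofLp = (fun i ↦
        fderiv ℝ (fun z ↦ u ((chartAt (𝔼 N) c).symm z)) y (EuclideanSpace.single i 1)) := by
    ext i
    rw [← inner_grad_coordVec hy hu, inner_coordVec_eq_sum hy, Matrix.mulVec, dotProduct]
    refine Finset.sum_congr rfl fun j _ ↦ ?_
    rw [mul_comm, gramMatrix, Matrix.of_apply, Matrix.of_apply, real_inner_comm]
  rw [← h, Matrix.mulVec_mulVec, Matrix.nonsing_inv_mul _ hdet, Matrix.one_mulVec]

theorem continuousOn_inv_gramMatrix_apply (c : M) (i j : Fin N) :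
    ContinuousOn (fun y ↦ (gramMatrix (N := N) c y)⁻¹ i j) (chartAt (𝔼 N) c).target := by
  have h : ContinuousOn (fun y ↦ gramMatrix (N := N) c y) (chartAt (𝔼 N) c).target :=
    continuousOn_pi.2 fun i ↦ continuousOn_pi.2 fun j ↦
      continuousOn_gramMatrix_apply (N := N) c i j
  have hd : ContinuousOn (fun y ↦ (gramMatrix (N := N) c y).det) (chartAt (𝔼 N) c).target :=
    (continuous_id.matrix_det).comp_continuousOn h
  have ha : ContinuousOn (fun y ↦ (gramMatrix (N := N) c y).adjugate i j) (chartAt (𝔼 N) c).target :=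
    (((continuous_id.matrix_adjugate).matrix_elem i j).comp_continuousOn h)
  refine ((hd.inv₀ fun y hy ↦ (gramMatrix_det_pos (N := N) hy).ne').mul ha).congr fun y hy ↦ ?_
  simp [Matrix.inv_def]

theorem aemeasurableField_grad {U : Set M} (hU : IsOpen U) {u : M → ℝ}
    (hu : ContMDiffOn (𝓡 N) 𝓘(ℝ, ℝ) 1 u U) : AEMeasurableField U (grad (N := N) u) := by
  intro c
  have ho := isOpen_target_inter_preimage (N := N) hU c
  have hd : ContinuousOn (fderiv ℝ (fun z ↦ u ((chartAt (𝔼 N) c).symm z)))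
      ((chartAt (𝔼 N) c).target ∩ (chartAt (𝔼 N) c).symm ⁻¹' U) :=
    (contDiffOn_comp_chart_symm (by exact_mod_cast le_top) hu c).continuousOn_fderiv_of_isOpen
      ho le_rfl
  have h1 : ContinuousOn (fun y ↦ WithLp.toLp 2 (Matrix.mulVec (gramMatrix c y)⁻¹ (fun i ↦
        fderiv ℝ (fun z ↦ u ((chartAt (𝔼 N) c).symm z)) y (EuclideanSpace.single i 1))))
      ((chartAt (𝔼 N) c).target ∩ (chartAt (𝔼 N) c).symm ⁻¹' U) := by
    refine (PiLp.continuous_toLp 2 _).comp_continuousOn (continuousOn_pi.2 fun i ↦ ?_)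
    simp only [Matrix.mulVec, dotProduct]
    exact continuousOn_finsetSum _ fun j _ ↦
      ((continuousOn_inv_gramMatrix_apply c i j).mono inter_subset_left).mul
        (hd.clm_apply continuousOn_const)
  have hm : MapsTo (chartAt (𝔼 N) c) (U ∩ (chartAt (𝔼 N) c).source)
      ((chartAt (𝔼 N) c).target ∩ (chartAt (𝔼 N) c).symm ⁻¹' U) := fun x hx ↦
    ⟨(chartAt (𝔼 N) c).map_source hx.2, by
      rw [mem_preimage, (chartAt (𝔼 N) c).left_inv hx.2]; exact hx.1⟩
  have hms := (hU.inter (chartAt (𝔼 N) c).open_source).measurableSet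
  refine ((h1.comp ((chartAt (𝔼 N) c).continuousOn.mono inter_subset_right) hm).aemeasurable
    hms).congr ?_
  filter_upwards [ae_restrict_mem hms] with x hx
  obtain ⟨y, hy, rfl⟩ := exists_target_symm_eq hx.2
  have hud : MDifferentiableAt (𝓡 N) 𝓘(ℝ, ℝ) u ((chartAt (𝔼 N) c).symm y) :=
    ((hu _ hx.1).contMDiffAt (hU.mem_nhds hx.1)).mdifferentiableAt one_ne_zero
  rw [Function.comp, (chartAt (𝔼 N) c).right_inv hy]
  exact (coordComp_grad hy hud).symm

end Measurability

/-! ### Comparison of the Riemannian volume with Lebesgue measure in a chart. -/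

section NullSets

variable {N : ℕ} {M : Type*} [TopologicalSpace M]
  [ChartedSpace (𝔼 N) M] [IsManifold (𝓡 N) ∞ M] [MeasurableSpace M] [BorelSpace M]
  [RiemannianBundle (fun x : M ↦ TangentSpace (𝓡 N) x)]

/-- A supremum of measures is not computed set by set. But each chart measure lives on the
complement of `A`, so the volume restricted to that complement is an upper bound for all of them,
and it vanishes on `A`. -/
theorem riemannianVolume_eq_zero {A : Set M} (hA : MeasurableSet A)
    (h : ∀ c : M, chartVolume (N := N) c A = 0) : riemannianVolume N M A = 0 := by
  have hle : riemannianVolume N M ≤ (riemannianVolume N M).restrict Aᶜ := by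
    refine iSup_le fun c ↦ ?_
    have h1 : (chartVolume (N := N) c).restrict Aᶜ = chartVolume c :=
      Measure.restrict_eq_self_of_ae_mem (compl_mem_ae_iff.2 (h c))
    rw [← h1]
    exact Measure.restrict_mono le_rfl (le_iSup (fun c : M ↦ chartVolume (N := N) c) c)
  refine le_antisymm ((hle A).trans ?_) zero_le
  rw [Measure.restrict_apply hA, inter_compl_self, measure_empty]

theorem aemeasurable_chart_symm (c : M) :
    AEMeasurable (chartAt (𝔼 N) c).symm (volume.restrict (chartAt (𝔼 N) c).target) :=
  (chartAt (𝔼 N) c).continuousOn_symm.aemeasurable (chartAt (𝔼 N) c).open_target.measurableSet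

theorem chartVolume_eq_zero {c : M} {A : Set M} (hA : MeasurableSet A)
    (h : volume ((chartAt (𝔼 N) c).target ∩ (chartAt (𝔼 N) c).symm ⁻¹' A) = 0) :
    chartVolume (N := N) c A = 0 := by
  have hac := withDensity_absolutelyContinuous
    (volume.restrict (chartAt (𝔼 N) c).target)
    (fun y ↦ ENNReal.ofReal (Real.sqrt (gramMatrix c y).det))
  rw [chartVolume, Measure.map_apply_of_aemeasurable
    ((aemeasurable_chart_symm c).mono_ac hac) hA]
  refine hac ?_
  rw [Measure.restrict_apply' (chartAt (𝔼 N) c).open_target.measurableSet, inter_comm]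
  exact h

/-- The volume involves every chart, so a set that is null in the chart at `c` must be null in any
other chart: transition maps are differentiable, hence send Lebesgue null sets to null sets. -/
theorem ae_restrict_of_ae_chart {c : M} {U : Set M} (hU : IsOpen U)
    (hUc : U ⊆ (chartAt (𝔼 N) c).source) {P : M → Prop}
    (h : ∀ᵐ y ∂volume.restrict ((chartAt (𝔼 N) c).target ∩ (chartAt (𝔼 N) c).symm ⁻¹' U),
      P ((chartAt (𝔼 N) c).symm y)) :
    ∀ᵐ x ∂(riemannianVolume N M).restrict U, P x := by
  rw [ae_restrict_iff' (isOpen_target_inter_preimage (N := N) hU c).measurableSet, ae_iff] at h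
  rw [ae_restrict_iff' hU.measurableSet, ae_iff]
  obtain ⟨B, hsub, hBm, hB⟩ := exists_measurable_superset_of_null h
  set A : Set M := U ∩ (chartAt (𝔼 N) c) ⁻¹' B with hAdef
  have hAm : MeasurableSet A := by
    classical
    -- The chart is continuous only on its source; a constant value off `U` makes it globally
    -- measurable.
    have := ((chartAt (𝔼 N) c).continuousOn.mono hUc).measurable_piecewise
      (continuousOn_const (c := (0 : 𝔼 N)) (s := Uᶜ)) hU.measurableSet
    have h2 := this hBm
    have : A = U ∩ (U.piecewise (chartAt (𝔼 N) c) (fun _ ↦ (0 : 𝔼 N))) ⁻¹' B := by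
      ext x
      simp only [hAdef, mem_inter_iff, mem_preimage]
      refine and_congr_right fun hx ↦ ?_
      rw [piecewise_eq_of_mem _ _ _ hx]
    rw [this]
    exact hU.measurableSet.inter h2
  refine measure_mono_null (t := A) (fun x hx ↦ ?_) (riemannianVolume_eq_zero hAm fun c' ↦ ?_)
  · simp only [mem_ofPred_eq, Classical.not_imp] at hx
    refine ⟨hx.1, hsub ?_⟩
    have hxs := hUc hx.1
    simp only [mem_ofPred_eq, Classical.not_imp, mem_inter_iff, mem_preimage,
      (chartAt (𝔼 N) c).left_inv hxs]
    exact ⟨⟨(chartAt (𝔼 N) c).map_source hxs, hx.1⟩, hx.2⟩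
  · refine chartVolume_eq_zero hAm ?_
    set S : Set (𝔼 N) := B ∩ ((chartAt (𝔼 N) c).target ∩ (chartAt (𝔼 N) c).symm ⁻¹'
      (chartAt (𝔼 N) c').source) with hS
    have hd : DifferentiableOn ℝ (fun y ↦ chartAt (𝔼 N) c' ((chartAt (𝔼 N) c).symm y)) S := by
      intro y hy
      refine DifferentiableAt.differentiableWithinAt ?_
      rw [← mdifferentiableAt_iff_differentiableAt]
      exact ((mdifferentiable_chartAt c').mdifferentiableAt hy.2.2).comp y
        ((mdifferentiable_chartAt c).symm.mdifferentiableAt hy.2.1)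
    have h0 := addHaar_image_eq_zero_of_differentiableOn_of_addHaar_eq_zero volume hd
      (measure_mono_null inter_subset_left hB)
    refine measure_mono_null ?_ h0
    rintro z ⟨hz, hzA⟩
    have hzs := hUc hzA.1
    refine ⟨chartAt (𝔼 N) c ((chartAt (𝔼 N) c').symm z), ⟨hzA.2,
      (chartAt (𝔼 N) c).map_source hzs, ?_⟩, ?_⟩
    · rw [mem_preimage, (chartAt (𝔼 N) c).left_inv hzs]
      exact (chartAt (𝔼 N) c').map_target hz
    · simp only [(chartAt (𝔼 N) c).left_inv hzs, (chartAt (𝔼 N) c').right_inv hz]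

variable [IsContMDiffRiemannianBundle (𝓡 N) ∞ (𝔼 N) (fun x : M ↦ TangentSpace (𝓡 N) x)]

/-- The density √det g is continuous and positive, so it is at least some `m > 0` on the compact
`K`; the constant is 1/m. -/
theorem exists_map_chart_symm_le {c : M} {U : Set M} (hU : IsOpen U) {K : Set (𝔼 N)}
    (hK : IsCompact K)
    (hKU : K ⊆ (chartAt (𝔼 N) c).target ∩ (chartAt (𝔼 N) c).symm ⁻¹' U) :
    ∃ C : ℝ≥0∞, C ≠ ⊤ ∧ (volume.restrict K).map (chartAt (𝔼 N) c).symm ≤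
      C • (riemannianVolume N M).restrict U := by
  have hKT : K ⊆ (chartAt (𝔼 N) c).target := fun y hy ↦ (hKU hy).1
  obtain ⟨m, hm, hmK⟩ : ∃ m : ℝ, 0 < m ∧ ∀ y ∈ K, m ≤ Real.sqrt (gramMatrix c y).det := by
    have h : ContinuousOn (fun y ↦ gramMatrix (N := N) c y) (chartAt (𝔼 N) c).target :=
      continuousOn_pi.2 fun i ↦ continuousOn_pi.2 fun j ↦
        continuousOn_gramMatrix_apply (N := N) c i j
    have hd : ContinuousOn (fun y ↦ Real.sqrt (gramMatrix (N := N) c y).det) K :=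
      (((continuous_id.matrix_det).comp_continuousOn h).mono hKT).sqrt
    rcases K.eq_empty_or_nonempty with rfl | hne
    · exact ⟨1, one_pos, by simp⟩
    · obtain ⟨y, hy, hmin⟩ := hK.exists_isMinOn hne hd
      exact ⟨_, Real.sqrt_pos.2 (gramMatrix_det_pos (N := N) (hKT hy)), fun z hz ↦ hmin hz⟩
  set ν := (volume.restrict (chartAt (𝔼 N) c).target).withDensity
    (fun y ↦ ENNReal.ofReal (Real.sqrt (gramMatrix c y).det)) with hν
  have hm0 : ENNReal.ofReal m ≠ 0 := by simpa using hm
  have hle : volume.restrict K ≤ (ENNReal.ofReal m)⁻¹ • ν := by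
    refine Measure.le_iff.2 fun s hs ↦ ?_
    rw [Measure.smul_apply, smul_eq_mul, ← ENNReal.div_eq_inv_mul,
      ENNReal.le_div_iff_mul_le (.inl hm0) (.inl ENNReal.ofReal_ne_top), mul_comm, hν,
      withDensity_apply _ hs, Measure.restrict_apply hs, Measure.restrict_restrict hs]
    calc ENNReal.ofReal m * volume (s ∩ K)
        = ∫⁻ _ in s ∩ K, ENNReal.ofReal m := by simp
      _ ≤ ∫⁻ y in s ∩ K, ENNReal.ofReal (Real.sqrt (gramMatrix c y).det) :=
          setLIntegral_mono' (hs.inter hK.measurableSet) fun y hy ↦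
            ENNReal.ofReal_le_ofReal (hmK y hy.2)
      _ ≤ _ := lintegral_mono_set (inter_subset_inter_right _ hKT)
  have hac := withDensity_absolutelyContinuous
    (volume.restrict (chartAt (𝔼 N) c).target)
    (fun y ↦ ENNReal.ofReal (Real.sqrt (gramMatrix c y).det))
  have hmeas : AEMeasurable (chartAt (𝔼 N) c).symm ν := (aemeasurable_chart_symm c).mono_ac hac
  have hmeasK : AEMeasurable (chartAt (𝔼 N) c).symm (volume.restrict K) :=
    (aemeasurable_chart_symm c).mono_measure (Measure.restrict_mono hKT le_rfl)
  refine ⟨(ENNReal.ofReal m)⁻¹, ENNReal.inv_ne_top.2 hm0, ?_⟩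
  have h1 : (volume.restrict K).map (chartAt (𝔼 N) c).symm ≤
      (ENNReal.ofReal m)⁻¹ • riemannianVolume N M := by
    refine Measure.le_iff.2 fun s hs ↦ ?_
    rw [Measure.map_apply_of_aemeasurable hmeasK hs]
    refine (hle _).trans ?_
    rw [Measure.smul_apply, Measure.smul_apply, ← Measure.map_apply_of_aemeasurable hmeas hs]
    exact mul_le_mul_right (le_iSup (fun c : M ↦ chartVolume (N := N) c) c s) _
  have h2 : ((volume.restrict K).map (chartAt (𝔼 N) c).symm).restrict U =
      (volume.restrict K).map (chartAt (𝔼 N) c).symm := by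
    refine Measure.restrict_eq_self_of_ae_mem ?_
    rw [ae_map_iff (p := fun x ↦ x ∈ U) hmeasK hU.measurableSet]
    filter_upwards [ae_restrict_mem hK.measurableSet] with y hy using (hKU hy).2
  rw [← h2, ← Measure.restrict_smul]
  exact Measure.restrict_mono le_rfl h1

end NullSets

/-- Convergence in L^q implies convergence in measure, hence a.e. convergence of a subsequence. -/
theorem exists_subseq_tendsto_ae_of_lintegral_rpow {α : Type*} [MeasurableSpace α] {μ : Measure α}
    {φ : ℕ → α → ℝ} {f : α → ℝ} (hφ : ∀ n, AEMeasurable (φ n) μ) (hf : AEMeasurable f μ)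
    {q : ℝ} (hq : 0 < q)
    (h : Tendsto (fun n ↦ ∫⁻ x, ‖φ n x - f x‖ₑ ^ q ∂μ) atTop (𝓝 0)) :
    ∃ ns : ℕ → ℕ, StrictMono ns ∧
      ∀ᵐ x ∂μ, Tendsto (fun k ↦ φ (ns k) x) atTop (𝓝 (f x)) := by
  have hq0 : ENNReal.ofReal q ≠ 0 := by simpa using hq
  have h1 : Tendsto (fun n ↦ eLpNorm (φ n - f) (ENNReal.ofReal q) μ) atTop (𝓝 0) := by
    have h2 := h.ennrpow_const (1 / q)
    rw [ENNReal.zero_rpow_of_pos (by positivity)] at h2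
    refine h2.congr fun n ↦ ?_
    rw [eLpNorm_eq_lintegral_rpow_enorm_toReal hq0 ENNReal.ofReal_ne_top,
      ENNReal.toReal_ofReal hq.le]
    rfl
  exact (tendstoInMeasure_of_tendsto_eLpNorm hq0 (fun n ↦ (hφ n).aestronglyMeasurable)
    hf.aestronglyMeasurable h1).exists_seq_tendsto_ae

/-! ### The weak chain rule in Euclidean space. -/

section Euclidean

variable {E : Type*} [NormedAddCommGroup E] [InnerProductSpace ℝ E] [FiniteDimensional ℝ E]
  [MeasurableSpace E] [BorelSpace E]

/-- Integration by parts against the constant function 1. -/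
theorem integral_fderiv_apply_eq_zero {w : E → ℝ} (hw : ContDiff ℝ 1 w)
    (hc : HasCompactSupport w) (v : E) : ∫ y, fderiv ℝ w y v = 0 := by
  have hd : Continuous (fun y ↦ fderiv ℝ w y v) :=
    (hw.continuous_fderiv one_ne_zero).clm_apply continuous_const
  have hdc : HasCompactSupport (fun y ↦ fderiv ℝ w y v) :=
    hc.fderiv_apply ℝ v
  have := integral_mul_fderiv_eq_neg_fderiv_mul_of_integrable (μ := (volume : Measure E))
    (f := fun _ ↦ (1 : ℝ)) (g := w) (v := v) (by simp)
    (by simpa using hd.integrable_of_hasCompactSupport hdc)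
    (by simpa using hw.continuous.integrable_of_hasCompactSupport hc)
    (fun _ _ ↦ by fun_prop) (fun _ _ ↦ hw.differentiable one_ne_zero _)
  simpa using this

/-- The chain rule for a limit in `L¹` of smooth functions, tested against `χ`. -/
theorem integral_chain_mul_eq_neg {V : Set E} (hV : IsOpen V) {f g χ : E → ℝ} {v : E}
    {φ : ℕ → E → ℝ} (hχ : ContDiff ℝ 1 χ) (hχc : HasCompactSupport χ) (hχV : tsupport χ ⊆ V)
    (hφ : ∀ n, ContDiffOn ℝ 1 (φ n) V)
    (hf : AEMeasurable f (volume.restrict (tsupport χ)))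
    (hg : AEMeasurable g (volume.restrict (tsupport χ)))
    (hφf : Tendsto (fun n ↦ ∫⁻ y in tsupport χ, ‖φ n y - f y‖ₑ) atTop (𝓝 0))
    (hφg : Tendsto (fun n ↦ ∫⁻ y in tsupport χ, ‖fderiv ℝ (φ n) y v - g y‖ₑ) atTop (𝓝 0))
    {F F' : ℝ → ℝ} (hF : ∀ t, HasDerivAt F (F' t) t) (hF'c : Continuous F') {C : ℝ}
    (hF'C : ∀ t, |F' t| ≤ C) :
    ∫ y, F' (f y) * g y * χ y = -∫ y, F (f y) * fderiv ℝ χ y v := by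
  set K := tsupport χ with hKdef
  have hK : IsCompact K := hχc
  have hC0 : 0 ≤ C := (abs_nonneg _).trans (hF'C 0)
  have hFc : Continuous F := continuous_iff_continuousAt.2 fun t ↦ (hF t).continuousAt
  have hFcd : ContDiff ℝ 1 F := by
    rw [contDiff_one_iff_deriv]
    refine ⟨fun t ↦ (hF t).differentiableAt, ?_⟩
    rwa [show deriv F = F' from funext fun t ↦ (hF t).deriv]
  -- `F` may be unbounded; its Lipschitz bound gives both the integrability of `F ∘ f` on `K` and L¹
  -- convergence.
  have hFlip (s t : ℝ) : |F s - F t| ≤ C * |s - t| := by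
    have := Convex.norm_image_sub_le_of_norm_hasDerivWithin_le (f := F) (f' := F') (s := univ)
      (x := t) (y := s) (C := C) (fun x _ ↦ (hF x).hasDerivWithinAt) (fun x _ ↦ hF'C x)
      convex_univ (mem_univ _) (mem_univ _)
    simpa using this
  have hχcont : Continuous χ := hχ.continuous
  have hdχ : Continuous (fun y ↦ fderiv ℝ χ y v) :=
    (hχ.continuous_fderiv one_ne_zero).clm_apply continuous_const
  obtain ⟨A, hA⟩ := hχcont.bounded_above_of_compact_support hχc
  obtain ⟨B, hB⟩ := hdχ.bounded_above_of_compact_support (hχc.fderiv_apply ℝ v)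
  have hA0 : 0 ≤ A := (norm_nonneg _).trans (hA 0)
  have hB0 : 0 ≤ B := (norm_nonneg _).trans (hB 0)
  have hφK (n : ℕ) : ContinuousOn (φ n) K := (hφ n).continuousOn.mono hχV
  have hdφK (n : ℕ) : ContinuousOn (fun y ↦ fderiv ℝ (φ n) y v) K :=
    (((hφ n).continuousOn_fderiv_of_isOpen hV le_rfl).mono hχV).clm_apply continuousOn_const
  have hφm (n : ℕ) : AEMeasurable (φ n) (volume.restrict K) :=
    (hφK n).aemeasurable hK.measurableSet
  have hdφm (n : ℕ) : AEMeasurable (fun y ↦ fderiv ℝ (φ n) y v) (volume.restrict K) :=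
    (hdφK n).aemeasurable hK.measurableSet
  have hn (n : ℕ) : ∫ y in K, F' (φ n y) * fderiv ℝ (φ n) y v * χ y =
      -∫ y in K, F (φ n y) * fderiv ℝ χ y v := by
    -- For the approximants, the identity says that the derivative of this product has integral
    -- zero. The product is C¹ everywhere: `φ n` is C¹ on `V`, and off `K` the product vanishes
    -- locally.
    set w : E → ℝ := fun y ↦ F (φ n y) * χ y with hw
    have hwz : ∀ y ∉ K, w =ᶠ[𝓝 y] 0 := fun y hy ↦ by
      filter_upwards [notMem_tsupport_iff_eventuallyEq.1 hy] with z hz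
      simp [hw, hz]
    have hwc : ContDiff ℝ 1 w := by
      rw [contDiff_iff_contDiffAt]
      intro y
      by_cases hy : y ∈ K
      · exact ((hFcd.contDiffAt).comp y ((hφ n).contDiffAt (hV.mem_nhds (hχV hy)))).mul
          hχ.contDiffAt
      · exact contDiffAt_const.congr_of_eventuallyEq (hwz y hy)
    have hwcs : HasCompactSupport w := hχc.mul_left
    have h0 := integral_fderiv_apply_eq_zero hwc hwcs v
    have hd : ∀ y ∈ K, fderiv ℝ w y v =
        F' (φ n y) * fderiv ℝ (φ n) y v * χ y + F (φ n y) * fderiv ℝ χ y v := by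
      intro y hy
      have h1 : HasFDerivAt (φ n) (fderiv ℝ (φ n) y) y :=
        (((hφ n).contDiffAt (hV.mem_nhds (hχV hy))).differentiableAt one_ne_zero).hasFDerivAt
      have h2 := ((hF (φ n y)).comp_hasFDerivAt y h1).mul
        ((hχ.differentiable one_ne_zero) y).hasFDerivAt
      have h3 : fderiv ℝ w y = _ := h2.fderiv
      rw [h3]
      simp
      ring
    have hz : ∀ y ∉ K, fderiv ℝ w y v = 0 := fun y hy ↦ by
      rw [(hwz y hy).fderiv_eq]; simp
    rw [← setIntegral_eq_integral_of_forall_compl_eq_zero hz,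
      setIntegral_congr_fun hK.measurableSet hd, integral_add] at h0
    · linarith
    · exact ContinuousOn.integrableOn_compact hK
        (((hF'c.comp_continuousOn (hφK n)).mul (hdφK n)).mul hχcont.continuousOn)
    · exact ContinuousOn.integrableOn_compact hK
        ((hFc.comp_continuousOn (hφK n)).mul hdχ.continuousOn)
  have hgi : Integrable g (volume.restrict K) := by
    obtain ⟨n, hn⟩ := (hφg.eventually (gt_mem_nhds one_pos)).exists
    have h1 : Integrable (fun y ↦ fderiv ℝ (φ n) y v - g y) (volume.restrict K) :=
      ⟨((hdφm n).sub hg).aestronglyMeasurable, hn.trans ENNReal.one_lt_top⟩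
    have h2 : Integrable (fun y ↦ fderiv ℝ (φ n) y v) (volume.restrict K) :=
      (hdφK n).integrableOn_compact hK
    exact (h2.sub h1).congr (.of_forall fun y ↦ by simp)
  have hfi : Integrable f (volume.restrict K) := by
    obtain ⟨n, hn⟩ := (hφf.eventually (gt_mem_nhds one_pos)).exists
    have h1 : Integrable (fun y ↦ φ n y - f y) (volume.restrict K) :=
      ⟨((hφm n).sub hf).aestronglyMeasurable, hn.trans ENNReal.one_lt_top⟩
    have h2 : Integrable (φ n) (volume.restrict K) := (hφK n).integrableOn_compact hK
    exact (h2.sub h1).congr (.of_forall fun y ↦ by simp)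
  have hFfm : AEMeasurable (fun y ↦ F (f y)) (volume.restrict K) :=
    hFc.measurable.comp_aemeasurable hf
  have hFfi : Integrable (fun y ↦ F (f y) * fderiv ℝ χ y v) (volume.restrict K) := by
    have hKfin : IsFiniteMeasure (volume.restrict K) := ⟨by simpa using hK.measure_lt_top⟩
    have hb : Integrable (fun y ↦ (|F 0| + C * |f y|) * B) (volume.restrict K) :=
      ((integrable_const _).add (hfi.abs.const_mul C)).mul_const B
    refine hb.mono' (hFfm.mul hdχ.measurable.aemeasurable).aestronglyMeasurable
      (.of_forall fun y ↦ ?_)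
    rw [norm_mul]
    refine mul_le_mul ?_ (hB y) (norm_nonneg _) (by positivity)
    have h1 := hFlip (f y) 0
    have h2 := abs_add_le (F (f y) - F 0) (F 0)
    rw [sub_zero] at h1
    rw [Real.norm_eq_abs]
    simp only [sub_add_cancel] at h2
    linarith
  have hF'gi : Integrable (fun y ↦ F' (f y) * g y * χ y) (volume.restrict K) := by
    refine (hgi.norm.const_mul (C * A)).mono'
      (((hF'c.measurable.comp_aemeasurable hf).mul hg).mul
        hχcont.measurable.aemeasurable).aestronglyMeasurable (.of_forall fun y ↦ ?_)
    rw [norm_mul, norm_mul]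
    calc ‖F' (f y)‖ * ‖g y‖ * ‖χ y‖ ≤ C * ‖g y‖ * A := by
          gcongr
          · exact hF'C _
          · exact hA _
      _ = C * A * ‖g y‖ := by ring
  -- `F'` is merely continuous, so the convergence of F'(φₙ) needs a.e. convergence of φₙ.
  obtain ⟨ns, hns, hae⟩ := exists_subseq_tendsto_ae_of_lintegral_rpow hφm hf one_pos
    (by simpa using hφf)
  have hlim1 : Tendsto (fun k ↦ ∫ y in K, F (φ (ns k) y) * fderiv ℝ χ y v) atTop
      (𝓝 (∫ y in K, F (f y) * fderiv ℝ χ y v)) := by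
    refine tendsto_integral_of_L1 _ hFfi.aestronglyMeasurable (.of_forall fun k ↦
      ContinuousOn.integrableOn_compact hK
        ((hFc.comp_continuousOn (hφK (ns k))).mul hdχ.continuousOn)) ?_
    have h1 : Tendsto (fun k ↦ ENNReal.ofReal (C * B) *
        ∫⁻ y in K, ‖φ (ns k) y - f y‖ₑ) atTop (𝓝 0) := by
      simpa using ENNReal.Tendsto.const_mul (hφf.comp hns.tendsto_atTop)
        (.inr ENNReal.ofReal_ne_top)
    refine tendsto_of_tendsto_of_tendsto_of_le_of_le tendsto_const_nhds h1 (fun _ ↦ zero_le)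
      fun k ↦ ?_
    simp only
    rw [← lintegral_const_mul' _ _ ENNReal.ofReal_ne_top]
    refine lintegral_mono fun y ↦ ?_
    rw [← ofReal_norm, ← ofReal_norm, ← ENNReal.ofReal_mul (by positivity)]
    refine ENNReal.ofReal_le_ofReal ?_
    rw [← sub_mul, norm_mul]
    calc ‖F (φ (ns k) y) - F (f y)‖ * ‖fderiv ℝ χ y v‖ ≤ (C * ‖φ (ns k) y - f y‖) * B := by
          gcongr
          · exact hFlip _ _
          · exact hB _
      _ = C * B * ‖φ (ns k) y - f y‖ := by ring
  have hlim2 : Tendsto (fun k ↦ ∫ y in K, F' (φ (ns k) y) * fderiv ℝ (φ (ns k)) y v * χ y) atTop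
      (𝓝 (∫ y in K, F' (f y) * g y * χ y)) := by
    have hm (k : ℕ) : AEStronglyMeasurable (fun y ↦ F' (φ (ns k) y) * g y * χ y)
        (volume.restrict K) :=
      (((hF'c.measurable.comp_aemeasurable (hφm _)).mul hg).mul
        hχcont.measurable.aemeasurable).aestronglyMeasurable
    have hbd (k : ℕ) (y : E) : ‖F' (φ (ns k) y) * g y * χ y‖ ≤ C * A * ‖g y‖ := by
      rw [norm_mul, norm_mul]
      calc ‖F' (φ (ns k) y)‖ * ‖g y‖ * ‖χ y‖ ≤ C * ‖g y‖ * A := by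
            gcongr
            · exact hF'C _
            · exact hA _
        _ = C * A * ‖g y‖ := by ring
    have hi (k : ℕ) : Integrable (fun y ↦ F' (φ (ns k) y) * fderiv ℝ (φ (ns k)) y v * χ y)
        (volume.restrict K) :=
      ContinuousOn.integrableOn_compact hK
        (((hF'c.comp_continuousOn (hφK _)).mul (hdφK _)).mul hχcont.continuousOn)
    have hi' (k : ℕ) : Integrable (fun y ↦ F' (φ (ns k) y) * g y * χ y) (volume.restrict K) :=
      (hgi.norm.const_mul (C * A)).mono' (hm k) (.of_forall (hbd k))
    -- Split F'(φₙ) ∂φₙ = F'(φₙ) g + F'(φₙ) (∂φₙ - g): dominated convergence handles the first term,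
    -- boundedness of `F'` and L¹ convergence the second.
    have h1 : Tendsto (fun k ↦ ∫ y in K, F' (φ (ns k) y) * g y * χ y) atTop
        (𝓝 (∫ y in K, F' (f y) * g y * χ y)) := by
      refine tendsto_integral_of_dominated_convergence _ hm (hgi.norm.const_mul (C * A))
        (fun k ↦ .of_forall (hbd k)) ?_
      filter_upwards [hae] with y hy
      exact (((hF'c.tendsto _).comp hy).mul_const _).mul_const _
    have h2 : Tendsto (fun k ↦ ∫ y in K, F' (φ (ns k) y) * (fderiv ℝ (φ (ns k)) y v - g y) * χ y)
        atTop (𝓝 (∫ _ in K, (0 : ℝ))) := by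
      refine tendsto_integral_of_L1 _ aestronglyMeasurable_const (.of_forall fun k ↦ ?_) ?_
      · refine ((hi k).sub (hi' k)).congr (.of_forall fun y ↦ ?_)
        simp only [Pi.sub_apply]
        ring
      have h3 : Tendsto (fun k ↦ ENNReal.ofReal (C * A) *
          ∫⁻ y in K, ‖fderiv ℝ (φ (ns k)) y v - g y‖ₑ) atTop (𝓝 0) := by
        simpa using ENNReal.Tendsto.const_mul (hφg.comp hns.tendsto_atTop)
          (.inr ENNReal.ofReal_ne_top)
      refine tendsto_of_tendsto_of_tendsto_of_le_of_le tendsto_const_nhds h3 (fun _ ↦ zero_le)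
        fun k ↦ ?_
      simp only
      rw [← lintegral_const_mul' _ _ ENNReal.ofReal_ne_top]
      refine lintegral_mono fun y ↦ ?_
      rw [← ofReal_norm, ← ofReal_norm, ← ENNReal.ofReal_mul (by positivity)]
      refine ENNReal.ofReal_le_ofReal ?_
      rw [sub_zero, norm_mul, norm_mul]
      calc ‖F' (φ (ns k) y)‖ * ‖fderiv ℝ (φ (ns k)) y v - g y‖ * ‖χ y‖
          ≤ C * ‖fderiv ℝ (φ (ns k)) y v - g y‖ * A := by
            gcongr
            · exact hF'C _
            · exact hA _
        _ = C * A * ‖fderiv ℝ (φ (ns k)) y v - g y‖ := by ring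
    have h4 := h1.add h2
    rw [integral_zero, add_zero] at h4
    refine h4.congr fun k ↦ ?_
    rw [← integral_add (hi' k)]
    · exact integral_congr_ae (.of_forall fun y ↦ by simp only; ring)
    · refine ((hi k).sub (hi' k)).congr (.of_forall fun y ↦ ?_)
      simp only [Pi.sub_apply]
      ring
  have hfin := tendsto_nhds_unique hlim2 (hlim1.neg.congr fun k ↦ (hn (ns k)).symm)
  rw [← setIntegral_eq_integral_of_forall_compl_eq_zero (s := K)
      (fun y hy ↦ by rw [image_eq_zero_of_notMem_tsupport hy, mul_zero]),
    ← setIntegral_eq_integral_of_forall_compl_eq_zero (s := K)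
      (f := fun y ↦ F (f y) * fderiv ℝ χ y v) (fun y hy ↦ by
        rw [(notMem_tsupport_iff_eventuallyEq.1 hy).fderiv_eq]; simp), hfin]

end Euclidean

/-- Hölder against 1. It turns L^q convergence into the L¹ convergence that the weak chain rule asks
for. -/
theorem lintegral_le_rpow_mul_measure_univ {α : Type*} [MeasurableSpace α] {μ : Measure α}
    {h : α → ℝ≥0∞} (hh : AEMeasurable h μ) {q : ℝ} (hq : 1 ≤ q) :
    ∫⁻ x, h x ∂μ ≤ (∫⁻ x, h x ^ q ∂μ) ^ (1 / q) * μ univ ^ (1 - 1 / q) := by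
  have hq0 : 0 < q := one_pos.trans_le hq
  have h1 := eLpNorm_le_eLpNorm_mul_rpow_measure_univ (μ := μ) (f := h) (p := 1)
    (q := ENNReal.ofReal q) (by simpa using hq) hh.aestronglyMeasurable
  rw [eLpNorm_one_eq_lintegral_enorm, eLpNorm_eq_lintegral_rpow_enorm_toReal (by simpa using hq0)
    ENNReal.ofReal_ne_top, ENNReal.toReal_ofReal hq0.le] at h1
  simpa using h1

/-! ### Sobolev functions in charts and uniqueness of weak gradients. -/

section Sobolev

variable {N : ℕ} {M : Type*} [TopologicalSpace M] [SecondCountableTopology M]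
  [ChartedSpace (𝔼 N) M] [IsManifold (𝓡 N) ∞ M] [MeasurableSpace M] [BorelSpace M]
  [RiemannianBundle (fun x : M ↦ TangentSpace (𝓡 N) x)]
  [IsContMDiffRiemannianBundle (𝓡 N) ∞ (𝔼 N) (fun x : M ↦ TangentSpace (𝓡 N) x)]

theorem aemeasurable_symm_restrict {c : M} {U : Set M} {K : Set (𝔼 N)}
    (hKU : K ⊆ (chartAt (𝔼 N) c).target ∩ (chartAt (𝔼 N) c).symm ⁻¹' U) :
    AEMeasurable (chartAt (𝔼 N) c).symm (volume.restrict K) :=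
  (aemeasurable_chart_symm c).mono_measure
    (Measure.restrict_mono (fun _ hy ↦ (hKU hy).1) le_rfl)

theorem map_symm_absolutelyContinuous {c : M} {U : Set M} (hU : IsOpen U) {K : Set (𝔼 N)}
    (hK : IsCompact K)
    (hKU : K ⊆ (chartAt (𝔼 N) c).target ∩ (chartAt (𝔼 N) c).symm ⁻¹' U) :
    (volume.restrict K).map (chartAt (𝔼 N) c).symm ≪ (riemannianVolume N M).restrict U := by
  obtain ⟨C, -, hC⟩ := exists_map_chart_symm_le hU hK hKU
  exact Measure.AbsolutelyContinuous.trans (Measure.absolutelyContinuous_of_le hC)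
    (Measure.smul_absolutelyContinuous)

theorem AEMeasurable.comp_chart_symm {β : Type*} [MeasurableSpace β] {c : M} {U : Set M}
    (hU : IsOpen U) {K : Set (𝔼 N)} (hK : IsCompact K)
    (hKU : K ⊆ (chartAt (𝔼 N) c).target ∩ (chartAt (𝔼 N) c).symm ⁻¹' U) {f : M → β}
    (hf : AEMeasurable f ((riemannianVolume N M).restrict U)) :
    AEMeasurable (fun y ↦ f ((chartAt (𝔼 N) c).symm y)) (volume.restrict K) :=
  (hf.mono_ac (map_symm_absolutelyContinuous hU hK hKU)).comp_aemeasurable'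
    (aemeasurable_symm_restrict hKU)

theorem ae_restrict_comp_chart_symm {c : M} {U : Set M}
    (hU : IsOpen U) {K : Set (𝔼 N)} (hK : IsCompact K)
    (hKU : K ⊆ (chartAt (𝔼 N) c).target ∩ (chartAt (𝔼 N) c).symm ⁻¹' U) {P : M → Prop}
    (h : ∀ᵐ x ∂(riemannianVolume N M).restrict U, P x) :
    ∀ᵐ y ∂volume.restrict K, P ((chartAt (𝔼 N) c).symm y) :=
  ae_of_ae_map (aemeasurable_symm_restrict hKU)
    ((map_symm_absolutelyContinuous hU hK hKU).ae_le h)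

/-- Domination of measures followed by Hölder on the finite measure space `K`. The constant does not
depend on `h`, so convergence in L^q(U) passes to L¹(K). -/
theorem exists_lintegral_comp_chart_symm_le {c : M} {U : Set M} (hU : IsOpen U) {K : Set (𝔼 N)}
    (hK : IsCompact K)
    (hKU : K ⊆ (chartAt (𝔼 N) c).target ∩ (chartAt (𝔼 N) c).symm ⁻¹' U) {q : ℝ} (hq : 1 ≤ q) :
    ∃ D : ℝ≥0∞, D ≠ ⊤ ∧ ∀ h : M → ℝ≥0∞, AEMeasurable h ((riemannianVolume N M).restrict U) →
      ∫⁻ y in K, h ((chartAt (𝔼 N) c).symm y) ≤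
        D * (∫⁻ x in U, h x ^ q ∂riemannianVolume N M) ^ (1 / q) := by
  obtain ⟨C, hCtop, hC⟩ := exists_map_chart_symm_le hU hK hKU
  have hq0 : 0 < q := one_pos.trans_le hq
  have hexp : 0 ≤ 1 - 1 / q := by
    rw [sub_nonneg, div_le_one hq0]; exact hq
  refine ⟨C ^ (1 / q) * volume K ^ (1 - 1 / q), ENNReal.mul_ne_top
    (ENNReal.rpow_ne_top_of_nonneg (by positivity) hCtop)
    (ENNReal.rpow_ne_top_of_nonneg hexp hK.measure_lt_top.ne), fun h hh ↦ ?_⟩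
  refine (lintegral_le_rpow_mul_measure_univ (AEMeasurable.comp_chart_symm hU hK hKU hh)
    hq).trans ?_
  rw [Measure.restrict_apply_univ, mul_comm, mul_right_comm, mul_comm]
  refine mul_le_mul_left ?_ _
  rw [← ENNReal.mul_rpow_of_nonneg _ _ (by positivity)]
  refine ENNReal.rpow_le_rpow ?_ (by positivity)
  have hac := map_symm_absolutelyContinuous hU hK hKU
  rw [← lintegral_map' (f := fun x ↦ h x ^ q) ((hh.pow_const q).mono_ac hac)
    (aemeasurable_symm_restrict hKU), ← smul_eq_mul, ← lintegral_smul_measure]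
  exact lintegral_mono' hC le_rfl

/-- The `i`-th partial derivative, in the chart at `c`, of a function with gradient `G`. -/
noncomputable def coordDeriv (c : M) (G : ∀ x : M, TangentSpace (𝓡 N) x) (i : Fin N) (y : 𝔼 N) :
    ℝ :=
  inner ℝ (G ((chartAt (𝔼 N) c).symm y)) (coordVec c i y)

theorem aemeasurable_coordDeriv {c : M} {U : Set M} (hU : IsOpen U) {K : Set (𝔼 N)}
    (hK : IsCompact K)
    (hKU : K ⊆ (chartAt (𝔼 N) c).target ∩ (chartAt (𝔼 N) c).symm ⁻¹' U)
    {G : ∀ x : M, TangentSpace (𝓡 N) x} (hG : AEMeasurableField U G) (i : Fin N) :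
    AEMeasurable (coordDeriv c G i) (volume.restrict K) := by
  have hKU' : K ⊆ (chartAt (𝔼 N) c).target ∩
      (chartAt (𝔼 N) c).symm ⁻¹' (U ∩ (chartAt (𝔼 N) c).source) := fun y hy ↦
    ⟨(hKU hy).1, (hKU hy).2, (chartAt (𝔼 N) c).map_target (hKU hy).1⟩
  have h : AEMeasurable (fun y ↦ ∑ j, fieldComp c G ((chartAt (𝔼 N) c).symm y) j *
      gramMatrix c y j i) (volume.restrict K) :=
    Finset.aemeasurable_fun_sum _ fun j _ ↦
      (AEMeasurable.comp_chart_symm (hU.inter (chartAt (𝔼 N) c).open_source) hK hKU'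
        (hG.coord c j)).mul (((continuousOn_gramMatrix_apply (N := N) c j i).mono
          (fun y hy ↦ (hKU hy).1)).aemeasurable hK.measurableSet)
  refine h.congr ?_
  filter_upwards [ae_restrict_mem hK.measurableSet] with y hy
  exact (inner_coordVec_eq_sum (hKU hy).1 (G _) i).symm

/-- |∂ᵢ| = √gᵢᵢ is continuous. -/
theorem exists_norm_coordVec_le {c : M} {K : Set (𝔼 N)} (hK : IsCompact K)
    (hKT : K ⊆ (chartAt (𝔼 N) c).target) (i : Fin N) :
    ∃ B : ℝ, ∀ y ∈ K, ‖coordVec c i y‖ ≤ B := by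
  obtain ⟨B, hB⟩ := hK.exists_bound_of_continuousOn
    (((continuousOn_gramMatrix_apply (N := N) c i i).mono hKT).sqrt)
  refine ⟨B, fun y hy ↦ ?_⟩
  rw [norm_eq_sqrt_real_inner]
  exact (le_abs_self _).trans (hB y hy)

/-- The approximants are read in the chart, one sequence serving all `K`. Derivatives are controlled
by |g(∇φₙ - G, ∂ᵢ)| ≤ |∇φₙ - G| |∂ᵢ|. -/
theorem HasSobolevGradOn.exists_chart_approx {q : ℝ} (hq : 1 ≤ q) {U : Set M} (hU : IsOpen U)
    {f : M → ℝ} {G : ∀ x : M, TangentSpace (𝓡 N) x} (hf : HasSobolevGradOn q U f G) (c : M) :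
    ∃ ψ : ℕ → 𝔼 N → ℝ,
      (∀ n, ContDiffOn ℝ 1 (ψ n)
        ((chartAt (𝔼 N) c).target ∩ (chartAt (𝔼 N) c).symm ⁻¹' U)) ∧
      ∀ K ⊆ (chartAt (𝔼 N) c).target ∩ (chartAt (𝔼 N) c).symm ⁻¹' U, IsCompact K →
        Tendsto (fun n ↦ ∫⁻ y in K, ‖ψ n y - f ((chartAt (𝔼 N) c).symm y)‖ₑ) atTop (𝓝 0) ∧
        ∀ i, Tendsto (fun n ↦ ∫⁻ y in K, ‖fderiv ℝ (ψ n) y (EuclideanSpace.single i 1) -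
          coordDeriv c G i y‖ₑ) atTop (𝓝 0) := by
  obtain ⟨φ, hφ, hφf, hφG⟩ := hf.exists_approx
  have hq0 : 0 < q := one_pos.trans_le hq
  have hφ1 (n : ℕ) : ContMDiffOn (𝓡 N) 𝓘(ℝ, ℝ) 1 (φ n) U :=
    (hφ n).1.of_le (by exact_mod_cast le_top)
  refine ⟨fun n y ↦ φ n ((chartAt (𝔼 N) c).symm y), fun n ↦
    contDiffOn_comp_chart_symm (by exact_mod_cast le_top) (hφ1 n) c, fun K hKU hK ↦ ?_⟩
  obtain ⟨D, hD, hDle⟩ := exists_lintegral_comp_chart_symm_le hU hK hKU hq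
  have lim {A : ℕ → ℝ≥0∞} (hA : Tendsto A atTop (𝓝 0)) {B : ℝ≥0∞} (hB : B ≠ ⊤) :
      Tendsto (fun n ↦ B * (D * A n ^ (1 / q))) atTop (𝓝 0) := by
    have h1 := hA.ennrpow_const (1 / q)
    rw [ENNReal.zero_rpow_of_pos (by positivity)] at h1
    simpa using ENNReal.Tendsto.const_mul (ENNReal.Tendsto.const_mul h1 (.inr hD)) (.inr hB)
  constructor
  · refine tendsto_of_tendsto_of_tendsto_of_le_of_le tendsto_const_nhds
      (lim hφf ENNReal.one_ne_top) (fun _ ↦ zero_le) fun n ↦ ?_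
    simp only [one_mul]
    exact hDle (fun x ↦ ‖φ n x - f x‖ₑ)
      (((hφ1 n).continuousOn.aemeasurable hU.measurableSet).sub hf.aemeasurable).enorm
  · intro i
    obtain ⟨B, hB⟩ := exists_norm_coordVec_le hK (fun y hy ↦ (hKU hy).1) i
    refine tendsto_of_tendsto_of_tendsto_of_le_of_le tendsto_const_nhds
      (lim hφG (ENNReal.ofReal_ne_top (r := B))) (fun _ ↦ zero_le) fun n ↦ ?_
    refine le_trans ?_ (mul_le_mul_right (hDle (fun x ↦ ‖grad (N := N) (φ n) x - G x‖ₑ)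
      (((aemeasurableField_grad hU (hφ1 n)).sub hf.aemeasurable_grad).enorm hU)) _)
    rw [← lintegral_const_mul' _ _ ENNReal.ofReal_ne_top]
    refine setLIntegral_mono' hK.measurableSet fun y hy ↦ ?_
    have hmd : MDifferentiableAt (𝓡 N) 𝓘(ℝ, ℝ) (φ n) ((chartAt (𝔼 N) c).symm y) :=
      (((hφ1 n) _ (hKU hy).2).contMDiffAt (hU.mem_nhds (hKU hy).2)).mdifferentiableAt one_ne_zero
    rw [← inner_grad_coordVec (hKU hy).1 hmd, coordDeriv, ← inner_sub_left, ← ofReal_norm,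
      ← ofReal_norm, ← ENNReal.ofReal_mul ((norm_nonneg _).trans (hB y hy))]
    refine ENNReal.ofReal_le_ofReal ((norm_inner_le_norm _ _).trans ?_)
    rw [mul_comm]
    exact mul_le_mul_of_nonneg_right (hB y hy) (norm_nonneg _)

theorem HasSobolevGradOn.integrableOn_coordDeriv {q : ℝ} (hq : 1 ≤ q) {U : Set M} (hU : IsOpen U)
    {f : M → ℝ} {G : ∀ x : M, TangentSpace (𝓡 N) x} (hf : HasSobolevGradOn q U f G) {c : M}
    {K : Set (𝔼 N)} (hK : IsCompact K)
    (hKU : K ⊆ (chartAt (𝔼 N) c).target ∩ (chartAt (𝔼 N) c).symm ⁻¹' U) (i : Fin N) :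
    IntegrableOn (coordDeriv c G i) K := by
  obtain ⟨ψ, hψ, hlim⟩ := hf.exists_chart_approx hq hU c
  have hc (n : ℕ) : ContinuousOn (fun y ↦ fderiv ℝ (ψ n) y (EuclideanSpace.single i 1)) K :=
    (((hψ n).continuousOn_fderiv_of_isOpen (isOpen_target_inter_preimage hU c) le_rfl).mono
      hKU).clm_apply continuousOn_const
  obtain ⟨n, hn⟩ := (((hlim K hKU hK).2 i).eventually (gt_mem_nhds one_pos)).exists
  have h1 : Integrable (fun y ↦ fderiv ℝ (ψ n) y (EuclideanSpace.single i 1) - coordDeriv c G i y)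
      (volume.restrict K) :=
    ⟨(((hc n).aemeasurable hK.measurableSet).sub
      (aemeasurable_coordDeriv hU hK hKU hf.aemeasurable_grad i)).aestronglyMeasurable,
      hn.trans ENNReal.one_lt_top⟩
  have h2 : Integrable (fun y ↦ fderiv ℝ (ψ n) y (EuclideanSpace.single i 1))
      (volume.restrict K) := (hc n).integrableOn_compact hK
  exact (h2.sub h1).congr (.of_forall fun y ↦ by simp)

theorem HasSobolevGradOn.integral_chain {q : ℝ} (hq : 1 ≤ q) {U : Set M} (hU : IsOpen U)
    {f : M → ℝ} {G : ∀ x : M, TangentSpace (𝓡 N) x} (hf : HasSobolevGradOn q U f G) {c : M}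
    {χ : 𝔼 N → ℝ} (hχ : ContDiff ℝ 1 χ) (hχc : HasCompactSupport χ)
    (hχU : tsupport χ ⊆ (chartAt (𝔼 N) c).target ∩ (chartAt (𝔼 N) c).symm ⁻¹' U) (i : Fin N)
    {F F' : ℝ → ℝ} (hF : ∀ t, HasDerivAt F (F' t) t) (hF'c : Continuous F') {C : ℝ}
    (hF'C : ∀ t, |F' t| ≤ C) :
    ∫ y, F' (f ((chartAt (𝔼 N) c).symm y)) * coordDeriv c G i y * χ y =
      -∫ y, F (f ((chartAt (𝔼 N) c).symm y)) * fderiv ℝ χ y (EuclideanSpace.single i 1) := by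
  obtain ⟨ψ, hψ, hlim⟩ := hf.exists_chart_approx hq hU c
  exact integral_chain_mul_eq_neg (isOpen_target_inter_preimage hU c)
    (f := fun y ↦ f ((chartAt (𝔼 N) c).symm y)) hχ hχc hχU hψ
    (AEMeasurable.comp_chart_symm hU hχc hχU hf.aemeasurable)
    (aemeasurable_coordDeriv hU hχc hχU hf.aemeasurable_grad i)
    (hlim _ hχU hχc).1 ((hlim _ hχU hχc).2 i) hF hF'c hF'C

theorem HasSobolevGradOn.integrableOn_mul_coordDeriv {q : ℝ} (hq : 1 ≤ q) {U : Set M}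
    (hU : IsOpen U)
    {f : M → ℝ} {G : ∀ x : M, TangentSpace (𝓡 N) x} (hf : HasSobolevGradOn q U f G) {c : M}
    {K : Set (𝔼 N)} (hK : IsCompact K)
    (hKU : K ⊆ (chartAt (𝔼 N) c).target ∩ (chartAt (𝔼 N) c).symm ⁻¹' U) (i : Fin N)
    {Φ : ℝ → ℝ} (hΦ : Measurable Φ) {C : ℝ} (hΦC : ∀ t, |Φ t| ≤ C) :
    IntegrableOn (fun y ↦ Φ (f ((chartAt (𝔼 N) c).symm y)) * coordDeriv c G i y) K :=
  (hf.integrableOn_coordDeriv hq hU hK hKU i).bdd_mul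
    (hΦ.comp_aemeasurable
      (AEMeasurable.comp_chart_symm hU hK hKU hf.aemeasurable)).aestronglyMeasurable
    (.of_forall fun _ ↦ hΦC _)

/-- By the chain rule both sides are weak gradients of the same function Φ(f) = Ψ(g), and weak
gradients are unique by the fundamental lemma. -/
theorem HasSobolevGradOn.ae_smul_eq_smul {q q' : ℝ} (hq : 1 ≤ q) (hq' : 1 ≤ q') {U : Set M}
    (hU : IsOpen U) {c : M} (hUc : U ⊆ (chartAt (𝔼 N) c).source) {f g : M → ℝ}
    {G H : ∀ x : M, TangentSpace (𝓡 N) x}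
    (hf : HasSobolevGradOn q U f G) (hg : HasSobolevGradOn q' U g H)
    {Φ Φ' Ψ Ψ' : ℝ → ℝ} (hΦ : ∀ t, HasDerivAt Φ (Φ' t) t) (hΦ' : Continuous Φ')
    (hΨ : ∀ t, HasDerivAt Ψ (Ψ' t) t) (hΨ' : Continuous Ψ') {C : ℝ}
    (hΦC : ∀ t, |Φ' t| ≤ C) (hΨC : ∀ t, |Ψ' t| ≤ C)
    (heq : ∀ᵐ x ∂(riemannianVolume N M).restrict U, Φ (f x) = Ψ (g x)) :
    ∀ᵐ x ∂(riemannianVolume N M).restrict U, Φ' (f x) • G x = Ψ' (g x) • H x := by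
  refine ae_restrict_of_ae_chart hU hUc ?_
  have ho := isOpen_target_inter_preimage (N := N) hU c
  have key (i : Fin N) := ho.ae_eq_zero_of_integral_contDiff_smul_eq_zero (μ := volume)
    (f := fun y ↦ Φ' (f ((chartAt (𝔼 N) c).symm y)) * coordDeriv c G i y -
      Ψ' (g ((chartAt (𝔼 N) c).symm y)) * coordDeriv c H i y) ?_ ?_
  · rw [ae_restrict_iff' ho.measurableSet]
    filter_upwards [ae_all_iff.2 key] with y hy hyU
    rw [← sub_eq_zero]
    refine eq_zero_of_inner_coordVec_eq_zero hyU.1 _ fun i ↦ ?_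
    rw [inner_sub_left, real_inner_smul_left, real_inner_smul_left]
    exact hy i hyU
  · rw [locallyIntegrableOn_iff ho.isLocallyClosed]
    exact fun K hKU hK ↦ (hf.integrableOn_mul_coordDeriv hq hU hK hKU i hΦ'.measurable hΦC).sub
      (hg.integrableOn_mul_coordDeriv hq' hU hK hKU i hΨ'.measurable hΨC)
  · intro χ hχ hχc hχU
    have hχ1 : ContDiff ℝ 1 χ := hχ.of_le (by exact_mod_cast le_top)
    have h1 := hf.integral_chain hq hU hχ1 hχc hχU i hΦ hΦ' hΦC
    have h2 := hg.integral_chain hq' hU hχ1 hχc hχU i hΨ hΨ' hΨC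
    have h3 : ∫ y, Φ (f ((chartAt (𝔼 N) c).symm y)) * fderiv ℝ χ y (EuclideanSpace.single i 1) =
        ∫ y, Ψ (g ((chartAt (𝔼 N) c).symm y)) * fderiv ℝ χ y (EuclideanSpace.single i 1) := by
      refine integral_congr_ae ?_
      have := ae_restrict_comp_chart_symm hU hχc hχU heq
      rw [ae_restrict_iff' hχc.measurableSet] at this
      filter_upwards [this] with y hy
      by_cases hyK : y ∈ tsupport χ
      · simp only [hy hyK]
      · rw [(notMem_tsupport_iff_eventuallyEq.1 hyK).fderiv_eq]; simp
    have hint {Θ : ℝ → ℝ} {f : M → ℝ} {G : ∀ x : M, TangentSpace (𝓡 N) x}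
        (h : IntegrableOn (fun y ↦ Θ (f ((chartAt (𝔼 N) c).symm y)) * coordDeriv c G i y)
          (tsupport χ)) :
        Integrable (fun y ↦ Θ (f ((chartAt (𝔼 N) c).symm y)) * coordDeriv c G i y * χ y) := by
      rw [← integrableOn_iff_integrable_of_support_subset (s := tsupport χ)]
      · exact h.mul_continuousOn hχ.continuous.continuousOn hχc
      · exact fun _ hy ↦ subset_tsupport χ (right_ne_zero_of_mul hy)
    have h4 := integral_sub
      (hint (hf.integrableOn_mul_coordDeriv hq hU hχc hχU i hΦ'.measurable hΦC))
      (hint (hg.integrableOn_mul_coordDeriv hq' hU hχc hχU i hΨ'.measurable hΨC))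
    rw [h1, h2, h3, sub_self] at h4
    rw [← h4]
    exact integral_congr_ae (.of_forall fun y ↦ by simp only [smul_eq_mul]; ring)

end Sobolev

/-! ### Truncated logarithms as admissible functions for the chain rule. -/

section LogCutoff

/-- The function `t ↦ Φ (β log t)` on `(0, ∞)`, extended by zero. -/
noncomputable def logComp (Φ : ℝ → ℝ) (β t : ℝ) : ℝ := if 0 < t then Φ (β * Real.log t) else 0

variable {Φ : ℝ → ℝ} {β : ℝ}

theorem exists_logComp_eq_zero (hc : HasCompactSupport Φ) (hβ : β ≠ 0) :
    ∃ a b : ℝ, 0 < a ∧ ∀ t ∉ Icc a b, logComp Φ β t = 0 := by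
  obtain ⟨R, hR⟩ := hc.isBounded.subset_closedBall 0
  have hβ' : 0 < |β| := abs_pos.2 hβ
  refine ⟨Real.exp (-(R / |β|)), Real.exp (R / |β|), Real.exp_pos _, fun t ht ↦ ?_⟩
  unfold logComp
  split_ifs with h0
  · by_contra hne
    have h1 := hR (subset_tsupport Φ hne)
    rw [mem_closedBall_zero_iff, Real.norm_eq_abs, abs_mul, mul_comm, ← le_div_iff₀ hβ',
      abs_le] at h1
    exact ht ⟨(Real.le_log_iff_exp_le h0).1 h1.1, (Real.log_le_iff_le_exp h0).1 h1.2⟩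
  · rfl

/-- Near 0, where the logarithm is singular, β log t leaves the support of `Φ` and the function is
zero. -/
theorem contDiff_logComp (hΦ : ContDiff ℝ 1 Φ) (hc : HasCompactSupport Φ) (hβ : β ≠ 0) :
    ContDiff ℝ 1 (logComp Φ β) := by
  obtain ⟨a, b, ha, hab⟩ := exists_logComp_eq_zero hc hβ
  rw [contDiff_iff_contDiffAt]
  intro t
  rcases lt_or_ge t a with ht | ht
  · refine (contDiffAt_const (c := (0 : ℝ))).congr_of_eventuallyEq ?_
    filter_upwards [Iio_mem_nhds ht] with s hs
    exact hab s fun h ↦ absurd h.1 (not_le.2 hs)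
  · have ht0 : 0 < t := ha.trans_le ht
    have h1 : ContDiffAt ℝ 1 (fun s ↦ Φ (β * Real.log s)) t :=
      hΦ.contDiffAt.comp t (contDiffAt_const.mul (Real.contDiffAt_log.2 ht0.ne'))
    refine h1.congr_of_eventuallyEq ?_
    filter_upwards [Ioi_mem_nhds ht0] with s hs
    exact if_pos hs

theorem hasCompactSupport_logComp (hc : HasCompactSupport Φ) (hβ : β ≠ 0) :
    HasCompactSupport (logComp Φ β) := by
  obtain ⟨a, b, -, hab⟩ := exists_logComp_eq_zero hc hβ
  exact HasCompactSupport.intro isCompact_Icc hab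

theorem deriv_logComp (hΦ : ContDiff ℝ 1 Φ) {t : ℝ} (ht : 0 < t) :
    deriv (logComp Φ β) t = deriv Φ (β * Real.log t) * (β / t) := by
  have h1 : HasDerivAt (fun s ↦ β * Real.log s) (β / t) t := by
    simpa [div_eq_mul_inv] using (Real.hasDerivAt_log ht.ne').const_mul β
  have h2 := ((hΦ.differentiable one_ne_zero) (β * Real.log t)).hasDerivAt.comp t h1
  refine (h2.congr_of_eventuallyEq ?_).deriv
  filter_upwards [Ioi_mem_nhds ht] with s hs
  exact if_pos hs

/-- The identity times a bump function. The bump is 1 out to |R| + 1, so the product agrees with the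
identity in a neighbourhood of each point of [-R, R]. -/
theorem exists_deriv_eq_one (R : ℝ) : ∃ Φ : ℝ → ℝ, ContDiff ℝ 1 Φ ∧ HasCompactSupport Φ ∧
    ∀ w, |w| ≤ R → deriv Φ w = 1 := by
  let b : ContDiffBump (0 : ℝ) := ⟨|R| + 1, |R| + 2, by positivity, by linarith⟩
  refine ⟨fun w ↦ w * b w, contDiff_id.mul b.contDiff, b.hasCompactSupport.mul_left,
    fun w hw ↦ ?_⟩
  have : (fun w ↦ w * b w) =ᶠ[𝓝 w] id := by
    have hwb : w ∈ Metric.ball (0 : ℝ) (|R| + 1) := by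
      rw [mem_ball_zero_iff, Real.norm_eq_abs]
      linarith [le_abs_self R]
    filter_upwards [Metric.isOpen_ball.mem_nhds hwb] with z hz
    rw [b.one_of_mem_closedBall (Metric.ball_subset_closedBall hz), mul_one, id]
  rw [this.deriv_eq, deriv_id]

end LogCutoff

/-! ### Gradients on the zero set, and logarithmic gradients. -/

section Sobolev

variable {N : ℕ} {M : Type*} [TopologicalSpace M] [SecondCountableTopology M]
  [ChartedSpace (𝔼 N) M] [IsManifold (𝓡 N) ∞ M] [MeasurableSpace M] [BorelSpace M]
  [RiemannianBundle (fun x : M ↦ TangentSpace (𝓡 N) x)]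
  [IsContMDiffRiemannianBundle (𝓡 N) ∞ (𝔼 N) (fun x : M ↦ TangentSpace (𝓡 N) x)]

/-- With Fₙ(t) = arctan((n+1)t)/(n+1), Fₙ → 0 uniformly while Fₙ' tends boundedly to the indicator
of {0}. The limit of the chain rule reads ∫ 1_{f=0} ∂ᵢf χ = 0 for every test function χ. -/
theorem HasSobolevGradOn.ae_eq_zero_of_eq_zero {q : ℝ} (hq : 1 ≤ q) {U : Set M}
    (hU : IsOpen U) {c : M} (hUc : U ⊆ (chartAt (𝔼 N) c).source) {f : M → ℝ}
    {G : ∀ x : M, TangentSpace (𝓡 N) x} (hf : HasSobolevGradOn q U f G) :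
    ∀ᵐ x ∂(riemannianVolume N M).restrict U, f x = 0 → G x = 0 := by
  refine ae_restrict_of_ae_chart hU hUc ?_
  have ho := isOpen_target_inter_preimage (N := N) hU c
  set J : ℝ → ℝ := indicator {0} (fun _ ↦ 1) with hJ
  have hJm : Measurable J := measurable_const.indicator (measurableSet_singleton 0)
  have hJb (t : ℝ) : |J t| ≤ 1 := by
    by_cases h : t = 0 <;> simp [hJ, h]
  have key (i : Fin N) := ho.ae_eq_zero_of_integral_contDiff_smul_eq_zero (μ := volume)
    (f := fun y ↦ J (f ((chartAt (𝔼 N) c).symm y)) * coordDeriv c G i y) ?_ ?_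
  · rw [ae_restrict_iff' ho.measurableSet]
    filter_upwards [ae_all_iff.2 key] with y hy hyU h0
    refine eq_zero_of_inner_coordVec_eq_zero hyU.1 _ fun i ↦ ?_
    have := hy i hyU
    simp only [h0, hJ, indicator_of_mem (mem_singleton (0 : ℝ)), one_mul] at this
    exact this
  · rw [locallyIntegrableOn_iff ho.isLocallyClosed]
    exact fun K hKU hK ↦ hf.integrableOn_mul_coordDeriv hq hU hK hKU i hJm hJb
  · intro χ hχ hχc hχU
    have hχ1 : ContDiff ℝ 1 χ := hχ.of_le (by exact_mod_cast le_top)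
    have hsupp {Θ : 𝔼 N → ℝ} : ∫ y, Θ y * coordDeriv c G i y * χ y =
        ∫ y in tsupport χ, Θ y * coordDeriv c G i y * χ y :=
      (setIntegral_eq_integral_of_forall_compl_eq_zero fun y hy ↦ by
        rw [image_eq_zero_of_notMem_tsupport hy, mul_zero]).symm
    let F' : ℕ → ℝ → ℝ := fun n t ↦ 1 / (1 + ((n + 1 : ℝ) * t) ^ 2)
    let F : ℕ → ℝ → ℝ := fun n t ↦ Real.arctan ((n + 1 : ℝ) * t) / (n + 1 : ℝ)
    have hn (n : ℕ) : (0 : ℝ) < n + 1 := by positivity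
    have hF (n : ℕ) (t : ℝ) : HasDerivAt (F n) (F' n t) t := by
      have h1 : HasDerivAt (fun t : ℝ ↦ (n + 1 : ℝ) * t) (n + 1 : ℝ) t := by
        simpa using (hasDerivAt_id t).const_mul (n + 1 : ℝ)
      have h2 := h1.arctan.div_const (n + 1 : ℝ)
      refine h2.congr_deriv ?_
      simp only [F']
      field_simp
    have hF'c (n : ℕ) : Continuous (F' n) := by
      refine continuous_const.div (by fun_prop) fun t ↦ ?_
      positivity
    have hF'0 (n : ℕ) (t : ℝ) : 0 ≤ F' n t := by positivity
    have hF'b (n : ℕ) (t : ℝ) : |F' n t| ≤ 1 := by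
      rw [abs_of_nonneg (hF'0 n t), div_le_one (by positivity)]
      linarith [sq_nonneg ((n + 1 : ℝ) * t)]
    -- |arctan| < π/2 < 2.
    have hFb (n : ℕ) (t : ℝ) : |F n t| ≤ 2 / (n + 1 : ℝ) := by
      rw [abs_div, abs_of_pos (hn n)]
      gcongr
      rw [abs_le]
      constructor <;> linarith [Real.pi_lt_four, Real.arctan_lt_pi_div_two ((n + 1 : ℝ) * t),
        Real.neg_pi_div_two_lt_arctan ((n + 1 : ℝ) * t)]
    have hF'lim (t : ℝ) : Tendsto (fun n ↦ F' n t) atTop (𝓝 (J t)) := by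
      by_cases h : t = 0
      · simp [F', hJ, h]
      · simp only [hJ, indicator_of_notMem (notMem_singleton_iff.2 h), F', one_div]
        refine Tendsto.inv_tendsto_atTop (tendsto_atTop_add_const_left _ _ ?_)
        simp_rw [mul_pow]
        refine Tendsto.atTop_mul_const (by positivity) ?_
        exact (tendsto_pow_atTop two_ne_zero).comp
          (tendsto_atTop_add_const_right _ _ tendsto_natCast_atTop_atTop)
    have hint := hf.integrableOn_coordDeriv hq hU hχc hχU i
    have hfm := AEMeasurable.comp_chart_symm hU hχc hχU hf.aemeasurable
    have hlim1 : Tendsto (fun n ↦ ∫ y, F' n (f ((chartAt (𝔼 N) c).symm y)) *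
        coordDeriv c G i y * χ y) atTop
        (𝓝 (∫ y, J (f ((chartAt (𝔼 N) c).symm y)) * coordDeriv c G i y * χ y)) := by
      simp_rw [hsupp]
      refine tendsto_integral_of_dominated_convergence
        (fun y ↦ ‖coordDeriv c G i y * χ y‖) (fun n ↦ ?_)
        (hint.mul_continuousOn hχ.continuous.continuousOn hχc).norm
        (fun n ↦ .of_forall fun y ↦ ?_) (.of_forall fun y ↦ ?_)
      · exact (((hF'c n).measurable.comp_aemeasurable hfm).mul
          hint.aemeasurable).mul hχ.continuous.measurable.aemeasurable |>.aestronglyMeasurable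
      · rw [mul_assoc, norm_mul]
        exact mul_le_of_le_one_left (norm_nonneg _) (hF'b n _)
      · exact ((hF'lim _).mul_const _).mul_const _
    have hdχ : Continuous (fun y ↦ fderiv ℝ χ y (EuclideanSpace.single i 1)) :=
      (hχ1.continuous_fderiv one_ne_zero).clm_apply continuous_const
    have hdχi : Integrable (fun y ↦ fderiv ℝ χ y (EuclideanSpace.single i 1)) :=
      hdχ.integrable_of_hasCompactSupport (hχc.fderiv_apply ℝ _)
    have hlim2 : Tendsto (fun n ↦ -∫ y, F n (f ((chartAt (𝔼 N) c).symm y)) *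
        fderiv ℝ χ y (EuclideanSpace.single i 1)) atTop (𝓝 0) := by
      rw [← neg_zero]
      refine Tendsto.neg (squeeze_zero_norm (fun n ↦ (norm_integral_le_of_norm_le
        (hdχi.norm.const_mul (2 / (n + 1 : ℝ))) (.of_forall fun y ↦ ?_)).trans_eq
          (integral_const_mul _ _)) ?_)
      · rw [norm_mul]
        exact mul_le_mul_of_nonneg_right (hFb n _) (norm_nonneg _)
      · have := (tendsto_one_div_add_atTop_nhds_zero_nat (𝕜 := ℝ)).const_mul 2 |>.mul_const
          (∫ y, ‖fderiv ℝ χ y (EuclideanSpace.single i 1)‖)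
        simpa [div_eq_mul_inv] using this
    have h := tendsto_nhds_unique (hlim1.congr fun n ↦
      hf.integral_chain hq hU hχ1 hχc hχU i (hF n) (hF'c n) (hF'b n)) hlim2
    rw [← h]
    exact integral_congr_ae (.of_forall fun y ↦ by simp only [smul_eq_mul]; ring)

/-- Differentiate log f = α log g. The derivative of the logarithm is unbounded, so Φ(log f) = Φ(α
log g) is differentiated instead, with Φ' = 1 on [-k, k]; the sets {|α log g| ≤ k} exhaust the
domain. -/
theorem HasSobolevGradOn.ae_smul_eq_smul_of_rpow {q q' : ℝ} (hq : 1 ≤ q) (hq' : 1 ≤ q')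
    {U : Set M} (hU : IsOpen U) {c : M} (hUc : U ⊆ (chartAt (𝔼 N) c).source) {f g : M → ℝ}
    {G H : ∀ x : M, TangentSpace (𝓡 N) x}
    (hf : HasSobolevGradOn q U f G) (hg : HasSobolevGradOn q' U g H) {α : ℝ} (hα : α ≠ 0)
    (hpos : ∀ᵐ x ∂(riemannianVolume N M).restrict U, 0 < g x)
    (heq : ∀ᵐ x ∂(riemannianVolume N M).restrict U, f x = g x ^ α) :
    ∀ᵐ x ∂(riemannianVolume N M).restrict U, (1 / f x) • G x = (α / g x) • H x := by
  have key (k : ℕ) : ∀ᵐ x ∂(riemannianVolume N M).restrict U, |α * Real.log (g x)| ≤ k →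
      (1 / f x) • G x = (α / g x) • H x := by
    obtain ⟨Φ, hΦ, hΦc, hΦ1⟩ := exists_deriv_eq_one k
    have h1 := contDiff_logComp hΦ hΦc one_ne_zero
    have h2 := contDiff_logComp hΦ hΦc hα
    obtain ⟨C₁, hC₁⟩ := (h1.continuous_deriv_one).bounded_above_of_compact_support
      (hasCompactSupport_logComp hΦc one_ne_zero).deriv
    obtain ⟨C₂, hC₂⟩ := (h2.continuous_deriv_one).bounded_above_of_compact_support
      (hasCompactSupport_logComp hΦc hα).deriv
    have h3 := hf.ae_smul_eq_smul hq hq' hU hUc hg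
      (fun t ↦ ((h1.differentiable one_ne_zero) t).hasDerivAt) h1.continuous_deriv_one
      (fun t ↦ ((h2.differentiable one_ne_zero) t).hasDerivAt) h2.continuous_deriv_one
      (C := max C₁ C₂) (fun t ↦ (hC₁ t).trans (le_max_left _ _))
      (fun t ↦ (hC₂ t).trans (le_max_right _ _)) (by
        filter_upwards [hpos, heq] with x hx hx'
        have hfx : 0 < f x := hx' ▸ Real.rpow_pos_of_pos hx α
        rw [logComp, logComp, if_pos hfx, if_pos hx, hx', Real.log_rpow hx, one_mul])
    filter_upwards [h3, hpos, heq] with x h3x hx hx' hk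
    have hfx : 0 < f x := hx' ▸ Real.rpow_pos_of_pos hx α
    rw [deriv_logComp hΦ hfx, deriv_logComp hΦ hx, hΦ1 _ hk, one_mul, one_mul,
      show Real.log (f x) = α * Real.log (g x) by rw [hx', Real.log_rpow hx], hΦ1 _ hk,
      one_mul] at h3x
    exact h3x
  filter_upwards [ae_all_iff.2 key] with x hx
  obtain ⟨k, hk⟩ := exists_nat_ge |α * Real.log (g x)|
  exact hx k hk

theorem ae_restrict_of_locally {X : Type*} [TopologicalSpace X] [SecondCountableTopology X]
    [MeasurableSpace X] [OpensMeasurableSpace X] {μ : Measure X} {Ω : Set X} (hΩ : IsOpen Ω)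
    {P : X → Prop}
    (h : ∀ x ∈ Ω, ∃ U, IsOpen U ∧ x ∈ U ∧ ∀ᵐ y ∂μ.restrict U, P y) :
    ∀ᵐ x ∂μ.restrict Ω, P x := by
  rw [ae_restrict_iff' hΩ.measurableSet, ae_iff]
  refine measure_null_of_locally_null _ fun x hx ↦ ?_
  rw [mem_ofPred_eq, Classical.not_imp] at hx
  obtain ⟨U, hU, hxU, hP⟩ := h x hx.1
  rw [ae_restrict_iff' hU.measurableSet, ae_iff] at hP
  refine ⟨_, inter_mem_nhdsWithin _ (hU.mem_nhds hxU), measure_mono_null (fun y hy ↦ ?_) hP⟩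
  rw [mem_ofPred_eq, Classical.not_imp]
  have h1 := hy.1
  rw [mem_ofPred_eq, Classical.not_imp] at h1
  exact ⟨hy.2, h1.2⟩

variable [T2Space M]

/-- Passes from relatively compact pieces of single charts, where the local Sobolev hypotheses can
be used, to `Ω`: such pieces surround each point, and null sets are a local matter. -/
theorem ae_restrict_of_small {Ω : Set M} (hΩ : IsOpen Ω) {P : M → Prop}
    (h : ∀ (c : M) (U : Set M), IsOpen U → U ⊆ (chartAt (𝔼 N) c).source → IsCompact (closure U) →
      closure U ⊆ Ω → ∀ᵐ x ∂(riemannianVolume N M).restrict U, P x) :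
    ∀ᵐ x ∂(riemannianVolume N M).restrict Ω, P x := by
  have : LocallyCompactSpace M := Manifold.locallyCompact_of_finiteDimensional (𝓡 N)
  refine ae_restrict_of_locally hΩ fun x hx ↦ ?_
  obtain ⟨U, hU, hxU, hUΩ, hUc⟩ := exists_open_between_and_isCompact_closure
    (isCompact_singleton (x := x))
    (hΩ.inter (chartAt (𝔼 N) x).open_source)
    (singleton_subset_iff.2 ⟨hx, mem_chart_source (𝔼 N) x⟩)
  exact ⟨U, hU, hxU rfl, h x U hU (fun y hy ↦ (hUΩ (subset_closure hy)).2) hUc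
    fun y hy ↦ (hUΩ hy).1⟩

theorem HasSobolevGradLoc.ae_eq_zero_of_eq_zero {q : ℝ} (hq : 1 ≤ q) {Ω : Set M}
    (hΩ : IsOpen Ω) {f : M → ℝ} {G : ∀ x : M, TangentSpace (𝓡 N) x}
    (hf : HasSobolevGradLoc q Ω f G) :
    ∀ᵐ x ∂(riemannianVolume N M).restrict Ω, f x = 0 → G x = 0 :=
  ae_restrict_of_small hΩ fun _ U hU hUc hUK hUΩ ↦
    (hf U hU hUK hUΩ).ae_eq_zero_of_eq_zero hq hU hUc

/-- A unit gradient cannot vanish, so {g = 0} is null; on its complement take norms in the identity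
of logarithmic gradients. -/
theorem HasSobolevGradLoc.ae_norm_div_eq_of_rpow {q q' : ℝ} (hq : 1 ≤ q) (hq' : 1 ≤ q')
    {Ω : Set M} (hΩ : IsOpen Ω) {f g : M → ℝ} {G H : ∀ x : M, TangentSpace (𝓡 N) x}
    (hf : HasSobolevGradLoc q Ω f G) (hg : HasSobolevGradLoc q' Ω g H) {α : ℝ} (hα : α ≠ 0)
    (hg0 : ∀ᵐ x ∂(riemannianVolume N M).restrict Ω, 0 ≤ g x)
    (hH : ∀ᵐ x ∂(riemannianVolume N M).restrict Ω, ‖H x‖ = 1)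
    (heq : ∀ᵐ x ∂(riemannianVolume N M).restrict Ω, f x = g x ^ α) :
    ∀ᵐ x ∂(riemannianVolume N M).restrict Ω, 0 < g x ∧ 0 < f x ∧ ‖G x‖ / f x = |α| / g x := by
  have hpos : ∀ᵐ x ∂(riemannianVolume N M).restrict Ω, 0 < g x := by
    filter_upwards [hg0, hH, hg.ae_eq_zero_of_eq_zero hq' hΩ] with x h0 h1 h2
    refine h0.lt_of_ne fun h ↦ ?_
    rw [h2 h.symm, norm_zero] at h1
    exact zero_ne_one h1
  have hsm : ∀ᵐ x ∂(riemannianVolume N M).restrict Ω, (1 / f x) • G x = (α / g x) • H x := by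
    refine ae_restrict_of_small hΩ fun c U hU hUc hUK hUΩ ↦ ?_
    have hle : (riemannianVolume N M).restrict U ≤ (riemannianVolume N M).restrict Ω :=
      Measure.restrict_mono (subset_closure.trans hUΩ) le_rfl
    exact (hf U hU hUK hUΩ).ae_smul_eq_smul_of_rpow hq hq' hU hUc (hg U hU hUK hUΩ) hα
      (ae_mono hle hpos) (ae_mono hle heq)
  filter_upwards [hpos, hsm, hH, heq] with x hx h1 h2 h3
  have hfx : 0 < f x := h3 ▸ Real.rpow_pos_of_pos hx α
  refine ⟨hx, hfx, ?_⟩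
  have h4 := congrArg norm h1
  rw [norm_smul, norm_smul, h2, mul_one, norm_div, norm_div, norm_one, Real.norm_eq_abs,
    Real.norm_eq_abs, Real.norm_eq_abs, abs_of_pos hx, abs_of_pos hfx] at h4
  rw [← h4]
  ring

end Sobolev

/-! ### The bounded C¹ substitute for t ↦ (t+ε)^(1-p). -/

section Cutoff

/-- A bounded `C¹` function on `ℝ` that equals `(t + ε) ^ (1 - p)` for `t ≥ 0`. -/
noncomputable def negPowCut (p ε t : ℝ) : ℝ :=
  if 0 ≤ t then (t + ε) ^ (1 - p) else 2 * ε ^ (1 - p) - (ε - t) ^ (1 - p)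

variable {p ε : ℝ}

/-- The branch t < 0 is the point reflection of the other through (0, ε^(1-p)), so the derivative is
even and the branches match to first order. -/
theorem hasDerivAt_negPowCut (hε : 0 < ε) (t : ℝ) :
    HasDerivAt (negPowCut p ε) ((1 - p) * (|t| + ε) ^ (-p)) t := by
  have hpos (t : ℝ) (ht : 0 ≤ t) :
      HasDerivAt (fun t ↦ (t + ε) ^ (1 - p)) ((1 - p) * (|t| + ε) ^ (-p)) t := by
    have h := ((hasDerivAt_id t).add_const ε).rpow_const (p := 1 - p)
      (.inl (by simp only [id]; positivity))
    refine h.congr_deriv ?_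
    simp only [id]
    rw [abs_of_nonneg ht, one_mul, show 1 - p - 1 = -p by ring]
  have hneg (t : ℝ) (ht : t ≤ 0) :
      HasDerivAt (fun t ↦ 2 * ε ^ (1 - p) - (ε - t) ^ (1 - p)) ((1 - p) * (|t| + ε) ^ (-p)) t := by
    have h := (((hasDerivAt_id t).const_sub ε).rpow_const (p := 1 - p)
      (.inl (by simp only [id]; linarith))).const_sub (2 * ε ^ (1 - p))
    refine h.congr_deriv ?_
    simp only [id]
    rw [abs_of_nonpos ht, show 1 - p - 1 = -p by ring, show -t + ε = ε - t by ring]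
    ring
  rcases lt_trichotomy t 0 with ht | rfl | ht
  · refine (hneg t ht.le).congr_of_eventuallyEq ?_
    filter_upwards [Iio_mem_nhds ht] with s hs
    exact if_neg (not_le.2 hs)
  · have h1 : HasDerivWithinAt (negPowCut p ε) ((1 - p) * (|(0 : ℝ)| + ε) ^ (-p)) (Ici 0) 0 :=
      ((hpos 0 le_rfl).hasDerivWithinAt).congr (fun s hs ↦ if_pos hs) (if_pos le_rfl)
    have h2 : HasDerivWithinAt (negPowCut p ε) ((1 - p) * (|(0 : ℝ)| + ε) ^ (-p)) (Iic 0) 0 := by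
      refine ((hneg 0 le_rfl).hasDerivWithinAt).congr (fun s hs ↦ ?_) ?_
      · rcases (mem_Iic.1 hs).lt_or_eq with h | rfl
        · exact if_neg (not_le.2 h)
        · simp [negPowCut]; ring
      · simp [negPowCut]; ring
    have h3 := h1.union h2
    rwa [union_comm, Iic_union_Ici, hasDerivWithinAt_univ] at h3
  · refine (hpos t ht.le).congr_of_eventuallyEq ?_
    filter_upwards [Ioi_mem_nhds ht] with s hs
    exact if_pos hs.le

theorem continuous_deriv_negPowCut (hε : 0 < ε) :
    Continuous (fun t ↦ (1 - p) * (|t| + ε) ^ (-p)) :=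
  continuous_const.mul ((continuous_abs.add continuous_const).rpow_const
    fun t ↦ .inl (add_pos_of_nonneg_of_pos (abs_nonneg t) hε).ne')

theorem continuous_negPowCut (hε : 0 < ε) : Continuous (negPowCut p ε) :=
  continuous_iff_continuousAt.2 fun t ↦ (hasDerivAt_negPowCut hε t).continuousAt

theorem contDiff_negPowCut (hε : 0 < ε) : ContDiff ℝ 1 (negPowCut p ε) := by
  rw [contDiff_one_iff_deriv]
  refine ⟨fun t ↦ (hasDerivAt_negPowCut hε t).differentiableAt, ?_⟩
  rw [show deriv (negPowCut p ε) = _ from funext fun t ↦ (hasDerivAt_negPowCut hε t).deriv]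
  exact continuous_deriv_negPowCut hε

theorem abs_deriv_negPowCut_le (hp : 1 < p) (hε : 0 < ε) (t : ℝ) :
    |(1 - p) * (|t| + ε) ^ (-p)| ≤ (p - 1) * ε ^ (-p) := by
  rw [abs_mul, abs_of_neg (by linarith), abs_of_nonneg (by positivity), neg_sub]
  refine mul_le_mul_of_nonneg_left ?_ (by linarith)
  exact Real.rpow_le_rpow_of_nonpos hε (by linarith [abs_nonneg t]) (by linarith)

/-- Negative `t` matters: the approximants of `ρ` may be negative, yet the test function must not
be. -/
theorem negPowCut_nonneg (hp : 1 < p) (hε : 0 < ε) (t : ℝ) : 0 ≤ negPowCut p ε t := by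
  unfold negPowCut
  split_ifs with h
  · positivity
  · have := Real.rpow_le_rpow_of_nonpos hε (y := ε - t) (z := 1 - p) (by linarith) (by linarith)
    have : 0 < ε ^ (1 - p) := by positivity
    linarith

theorem negPowCut_le (hp : 1 < p) (hε : 0 < ε) (t : ℝ) :
    negPowCut p ε t ≤ 2 * ε ^ (1 - p) := by
  have h0 : 0 < ε ^ (1 - p) := by positivity
  unfold negPowCut
  split_ifs with h
  · have := Real.rpow_le_rpow_of_nonpos hε (y := t + ε) (z := 1 - p) (by linarith) (by linarith)
    linarith
  · have : 0 ≤ (ε - t) ^ (1 - p) := Real.rpow_nonneg (by linarith) _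
    linarith

end Cutoff

/-! ### Limit passage and absorption on an abstract measure space. -/

section Integrals

/-- At γ = 0 both sides vanish because p > 1, whatever value 0^(p-2) has. -/
theorem rpow_sub_two_mul_self {γ p : ℝ} (hγ : 0 ≤ γ) (hp : 1 < p) :
    γ ^ (p - 2) * γ = γ ^ (p - 1) := by
  rcases hγ.eq_or_lt with rfl | h
  · rw [mul_zero, Real.zero_rpow (by linarith)]
  · rw [← Real.rpow_add_one h.ne']; ring_nf

theorem rpow_sub_one_mul_self {γ p : ℝ} (hγ : 0 ≤ γ) (hp : 1 < p) :
    γ ^ (p - 1) * γ = γ ^ p := by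
  rcases hγ.eq_or_lt with rfl | h
  · rw [mul_zero, Real.zero_rpow (by linarith)]
  · rw [← Real.rpow_add_one h.ne']; ring_nf

theorem rpow_sub_one_mul_le_add {γ β p : ℝ} (hγ : 0 ≤ γ) (hβ : 0 ≤ β) (hp : 1 < p) :
    γ ^ (p - 1) * β ≤ γ ^ p + β ^ p := by
  have h1 : 0 ≤ γ ^ p := by positivity
  have h2 : 0 ≤ β ^ p := by positivity
  rcases le_total β γ with h | h
  · calc γ ^ (p - 1) * β ≤ γ ^ (p - 1) * γ := by gcongr
      _ = γ ^ p := rpow_sub_one_mul_self hγ hp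
      _ ≤ _ := by linarith
  · calc γ ^ (p - 1) * β ≤ β ^ (p - 1) * β := by gcongr
      _ = β ^ p := rpow_sub_one_mul_self hβ hp
      _ ≤ _ := by linarith

/-- Divide by I^(1-1/p) and raise to the power p. This needs `I` finite, which is why the Hardy
inequality is first proved with ε > 0. -/
theorem le_rpow_mul_of_mul_le {I J p : ℝ} (hp : 1 < p) (hI : 0 ≤ I) (hJ : 0 ≤ J)
    (h : (p - 1) * I ≤ p * (I ^ (1 - 1 / p) * J ^ (1 / p))) : I ≤ (p / (p - 1)) ^ p * J := by
  have hp0 : 0 < p := by linarith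
  have hp1 : 0 < p - 1 := by linarith
  rcases hI.eq_or_lt with rfl | hI
  · positivity
  have h1 : I = I ^ (1 - 1 / p) * I ^ (1 / p) := by
    rw [← Real.rpow_add hI]; simp
  have h2 : I ^ (1 / p) ≤ p / (p - 1) * J ^ (1 / p) := by
    have hpos : 0 < I ^ (1 - 1 / p) := by positivity
    refine le_of_mul_le_mul_left ?_ hpos
    rw [← h1, div_mul_eq_mul_div, mul_div_assoc', le_div_iff₀ hp1]
    linarith
  have h3 := Real.rpow_le_rpow (by positivity) h2 hp0.le
  rwa [Real.mul_rpow (by positivity) (by positivity), ← Real.rpow_mul hI.le, ← Real.rpow_mul hJ,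
    one_div_mul_cancel hp0.ne', Real.rpow_one, Real.rpow_one] at h3

variable {α : Type*} [MeasurableSpace α] {ν : Measure α} {p ε : ℝ}

theorem integrable_rpow_sub_one_mul (hp : 1 < p) {γ β : α → ℝ} (hγ0 : ∀ x, 0 ≤ γ x)
    (hβ0 : ∀ x, 0 ≤ β x) (hγ : AEMeasurable γ ν) (hβ : AEMeasurable β ν)
    (hγi : Integrable (fun x ↦ γ x ^ p) ν) (hβi : Integrable (fun x ↦ β x ^ p) ν) :
    Integrable (fun x ↦ γ x ^ (p - 1) * β x) ν := by
  refine (hγi.add hβi).mono' ((hγ.pow_const _).mul hβ).aestronglyMeasurable (.of_forall fun x ↦ ?_)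
  rw [Real.norm_of_nonneg (mul_nonneg (Real.rpow_nonneg (hγ0 x) _) (hβ0 x))]
  exact rpow_sub_one_mul_le_add (hγ0 x) (hβ0 x) hp

/-- Hölder with exponents p/(p-1) and p, since γ^(p-1) lies in L^(p/(p-1)). -/
theorem tendsto_lintegral_rpow_sub_one_mul (hp : 1 < p) {γ : α → ℝ} {e : ℕ → α → ℝ}
    (hγ0 : ∀ x, 0 ≤ γ x) (hγ : AEMeasurable γ ν) (he : ∀ n, AEMeasurable (e n) ν)
    (hγi : Integrable (fun x ↦ γ x ^ p) ν)
    (hlim : Tendsto (fun n ↦ ∫⁻ x, ‖e n x‖ₑ ^ p ∂ν) atTop (𝓝 0)) :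
    Tendsto (fun n ↦ ∫⁻ x, ‖γ x ^ (p - 1)‖ₑ * ‖e n x‖ₑ ∂ν) atTop (𝓝 0) := by
  have hp0 : 0 < p := by linarith
  have hp1 : 0 < p - 1 := by linarith
  have hpq : (p / (p - 1)).HolderConjugate p := (Real.HolderConjugate.conjExponent hp).symm
  have hfin : ∫⁻ x, ‖γ x ^ (p - 1)‖ₑ ^ (p / (p - 1)) ∂ν ≠ ⊤ := by
    refine ne_of_eq_of_ne (lintegral_congr fun x ↦ ?_) hγi.hasFiniteIntegral.ne
    rw [Real.enorm_of_nonneg (Real.rpow_nonneg (hγ0 x) _),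
      Real.enorm_of_nonneg (Real.rpow_nonneg (hγ0 x) _),
      ENNReal.ofReal_rpow_of_nonneg (Real.rpow_nonneg (hγ0 x) _) (by positivity),
      ← Real.rpow_mul (hγ0 x), mul_div_cancel₀ _ hp1.ne']
  have h1 := hlim.ennrpow_const (1 / p)
  rw [ENNReal.zero_rpow_of_pos (by positivity)] at h1
  have h2 := ENNReal.Tendsto.const_mul
    (a := (∫⁻ x, ‖γ x ^ (p - 1)‖ₑ ^ (p / (p - 1)) ∂ν) ^ (1 / (p / (p - 1)))) h1
    (.inr (ENNReal.rpow_ne_top_of_nonneg (by positivity) hfin))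
  rw [mul_zero] at h2
  exact tendsto_of_tendsto_of_tendsto_of_le_of_le tendsto_const_nhds h2 (fun _ ↦ zero_le)
    fun n ↦ ENNReal.lintegral_mul_le_Lp_mul_Lq ν hpq (hγ.pow_const _).enorm (he n).enorm

/-- The limit, along approximations `r n` of `r`, of the inequality obtained by testing with
`|u| ^ p * negPowCut p ε (r n)`. -/
theorem integral_limit_nonneg (hp : 1 < p) (hε : 0 < ε) {γ β b u r : α → ℝ}
    {rn k e : ℕ → α → ℝ} (hγ0 : ∀ x, 0 ≤ γ x) (hβ0 : ∀ x, 0 ≤ β x) (he0 : ∀ n x, 0 ≤ e n x)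
    (hγ : AEMeasurable γ ν) (hβ : AEMeasurable β ν) (hb : AEMeasurable b ν)
    (hu : AEMeasurable u ν) (hr : AEMeasurable r ν) (hrn : ∀ n, AEMeasurable (rn n) ν)
    (hk : ∀ n, AEMeasurable (k n) ν) (he : ∀ n, AEMeasurable (e n) ν)
    (hbβ : ∀ x, |b x| ≤ γ x * β x) (hke : ∀ n x, |k n x - γ x ^ 2| ≤ γ x * e n x)
    {m : ℝ} (hm : ∀ x, |u x| ≤ m)
    (hγi : Integrable (fun x ↦ γ x ^ p) ν) (hβi : Integrable (fun x ↦ β x ^ p) ν)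
    (hlim : Tendsto (fun n ↦ ∫⁻ x, ‖e n x‖ₑ ^ p ∂ν) atTop (𝓝 0))
    (hrlim : ∀ᵐ x ∂ν, Tendsto (fun n ↦ rn n x) atTop (𝓝 (r x)))
    (hnn : ∀ n, 0 ≤ ∫ x, γ x ^ (p - 2) * (p * |u x| ^ (p - 2) * u x * negPowCut p ε (rn n x) * b x +
      |u x| ^ p * ((1 - p) * (|rn n x| + ε) ^ (-p)) * k n x) ∂ν) :
    Integrable (fun x ↦ γ x ^ (p - 2) * b x * (p * |u x| ^ (p - 2) * u x) *
      negPowCut p ε (r x) + γ x ^ p * |u x| ^ p * ((1 - p) * (|r x| + ε) ^ (-p))) ν ∧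
    0 ≤ ∫ x, γ x ^ (p - 2) * b x * (p * |u x| ^ (p - 2) * u x) * negPowCut p ε (r x) +
      γ x ^ p * |u x| ^ p * ((1 - p) * (|r x| + ε) ^ (-p)) ∂ν := by
  -- In the application γ = |∇ρ|, β = |∇u|, b = g(∇ρ, ∇u), r = ρ, and `rn n` is an approximant of ρ,
  -- with `k n` = g(∇ρ, ∇(rn n)) and `e n` = |∇(rn n) - ∇ρ|.
  have hp0 : 0 < p := by linarith
  have hcut := continuous_negPowCut (p := p) hε
  have hcut' := continuous_deriv_negPowCut (p := p) hε
  set h : ℝ → ℝ := negPowCut p ε with hh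
  set h' : ℝ → ℝ := fun t ↦ (1 - p) * (|t| + ε) ^ (-p) with hh'
  set H := 2 * ε ^ (1 - p)
  set H' := (p - 1) * ε ^ (-p) with hH'
  have hH'0 : 0 ≤ H' := mul_nonneg (by linarith) (by positivity)
  have hhb (t : ℝ) : |h t| ≤ H := by
    rw [abs_of_nonneg (negPowCut_nonneg hp hε t)]; exact negPowCut_le hp hε t
  have hhb' (t : ℝ) : |h' t| ≤ H' := abs_deriv_negPowCut_le hp hε t
  have hA0 (x : α) : |γ x ^ (p - 2) * b x * (p * |u x| ^ (p - 2) * u x)| ≤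
      p * m ^ (p - 1) * (γ x ^ (p - 1) * β x) := by
    have h1 : |γ x ^ (p - 2) * b x| ≤ γ x ^ (p - 1) * β x := by
      rw [abs_mul, abs_of_nonneg (Real.rpow_nonneg (hγ0 x) _), ← rpow_sub_two_mul_self (hγ0 x) hp,
        mul_assoc]
      exact mul_le_mul_of_nonneg_left (hbβ x) (Real.rpow_nonneg (hγ0 x) _)
    have h2 : |p * |u x| ^ (p - 2) * u x| ≤ p * m ^ (p - 1) := by
      rw [abs_mul, abs_mul, abs_of_pos hp0, abs_of_nonneg (Real.rpow_nonneg (abs_nonneg _) _),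
        mul_assoc, rpow_sub_two_mul_self (abs_nonneg _) hp]
      exact mul_le_mul_of_nonneg_left (Real.rpow_le_rpow (abs_nonneg _) (hm x) (by linarith)) hp0.le
    rw [abs_mul, mul_comm]
    exact mul_le_mul h2 h1 (abs_nonneg _) (by
      have := (abs_nonneg _).trans (hm x); positivity)
  have hup (x : α) : |(|u x| ^ p)| ≤ m ^ p := by
    rw [abs_of_nonneg (Real.rpow_nonneg (abs_nonneg _) _)]
    exact Real.rpow_le_rpow (abs_nonneg _) (hm x) hp0.le
  have hγβ := integrable_rpow_sub_one_mul hp hγ0 hβ0 hγ hβ hγi hβi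
  have hum : AEMeasurable (fun x ↦ p * |u x| ^ (p - 2) * u x) ν :=
    ((hu.abs.pow_const _).const_mul p).mul hu
  have hupm : AEMeasurable (fun x ↦ |u x| ^ p) ν := hu.abs.pow_const _
  have hAm (s : α → ℝ) (hs : AEMeasurable s ν) : AEStronglyMeasurable
      (fun x ↦ γ x ^ (p - 2) * b x * (p * |u x| ^ (p - 2) * u x) * h (s x)) ν :=
    ((((hγ.pow_const _).mul hb).mul hum).mul
      (hcut.measurable.comp_aemeasurable hs)).aestronglyMeasurable
  have hAb (s : α → ℝ) (x : α) :
      ‖γ x ^ (p - 2) * b x * (p * |u x| ^ (p - 2) * u x) * h (s x)‖ ≤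
      p * m ^ (p - 1) * (γ x ^ (p - 1) * β x) * H := by
    rw [Real.norm_eq_abs, abs_mul]
    exact mul_le_mul (hA0 x) (hhb _) (abs_nonneg _) ((abs_nonneg _).trans (hA0 x))
  have hAbi : Integrable (fun x ↦ p * m ^ (p - 1) * (γ x ^ (p - 1) * β x) * H) ν :=
    (hγβ.const_mul _).mul_const _
  have hAi (s : α → ℝ) (hs : AEMeasurable s ν) : Integrable
      (fun x ↦ γ x ^ (p - 2) * b x * (p * |u x| ^ (p - 2) * u x) * h (s x)) ν :=
    hAbi.mono' (hAm s hs) (.of_forall (hAb s))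
  have hBm (s : α → ℝ) (hs : AEMeasurable s ν) : AEStronglyMeasurable
      (fun x ↦ γ x ^ p * |u x| ^ p * h' (s x)) ν :=
    (((hγ.pow_const _).mul hupm).mul
      (hcut'.measurable.comp_aemeasurable hs)).aestronglyMeasurable
  have hBb (s : α → ℝ) (x : α) : ‖γ x ^ p * |u x| ^ p * h' (s x)‖ ≤ γ x ^ p * m ^ p * H' := by
    rw [Real.norm_eq_abs, abs_mul, abs_mul, abs_of_nonneg (Real.rpow_nonneg (hγ0 x) p)]
    have h1 := Real.rpow_nonneg (hγ0 x) p
    have h2 := (abs_nonneg _).trans (hup x)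
    exact mul_le_mul (mul_le_mul_of_nonneg_left (hup x) h1) (hhb' _) (abs_nonneg _)
      (mul_nonneg h1 h2)
  have hBbi : Integrable (fun x ↦ γ x ^ p * m ^ p * H') ν := (hγi.mul_const _).mul_const _
  have hBi (s : α → ℝ) (hs : AEMeasurable s ν) : Integrable
      (fun x ↦ γ x ^ p * |u x| ^ p * h' (s x)) ν :=
    hBbi.mono' (hBm s hs) (.of_forall (hBb s))
  have hlimA : Tendsto (fun n ↦ ∫ x, γ x ^ (p - 2) * b x * (p * |u x| ^ (p - 2) * u x) *
      h (rn n x) ∂ν) atTop (𝓝 (∫ x, γ x ^ (p - 2) * b x * (p * |u x| ^ (p - 2) * u x) *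
      h (r x) ∂ν)) := by
    refine tendsto_integral_of_dominated_convergence _ (fun n ↦ hAm _ (hrn n)) hAbi
      (fun n ↦ .of_forall (hAb (rn n))) ?_
    filter_upwards [hrlim] with x hx
    exact ((hcut.tendsto _).comp hx).const_mul _
  have hlimB : Tendsto (fun n ↦ ∫ x, γ x ^ p * |u x| ^ p * h' (rn n x) ∂ν) atTop
      (𝓝 (∫ x, γ x ^ p * |u x| ^ p * h' (r x) ∂ν)) := by
    refine tendsto_integral_of_dominated_convergence _ (fun n ↦ hBm _ (hrn n)) hBbi
      (fun n ↦ .of_forall (hBb (rn n))) ?_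
    filter_upwards [hrlim] with x hx
    exact ((hcut'.tendsto _).comp hx).const_mul _
  -- The error of replacing `k n` by γ², bounded by a multiple of γ^(p-1) · `e n`, whose integral
  -- tends to 0.
  have hCm (n : ℕ) : AEStronglyMeasurable
      (fun x ↦ |u x| ^ p * h' (rn n x) * (γ x ^ (p - 2) * (k n x - γ x ^ 2))) ν :=
    ((hupm.mul (hcut'.measurable.comp_aemeasurable (hrn n))).mul
      ((hγ.pow_const _).mul ((hk n).sub (hγ.pow_const _)))).aestronglyMeasurable
  have hCb (n : ℕ) (x : α) :
      ‖|u x| ^ p * h' (rn n x) * (γ x ^ (p - 2) * (k n x - γ x ^ 2))‖ ≤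
        m ^ p * H' * (γ x ^ (p - 1) * e n x) := by
    have h1 : |γ x ^ (p - 2) * (k n x - γ x ^ 2)| ≤ γ x ^ (p - 1) * e n x := by
      rw [abs_mul, abs_of_nonneg (Real.rpow_nonneg (hγ0 x) _), ← rpow_sub_two_mul_self (hγ0 x) hp,
        mul_assoc]
      exact mul_le_mul_of_nonneg_left (hke n x) (Real.rpow_nonneg (hγ0 x) _)
    have h2 := (abs_nonneg _).trans (hup x)
    rw [Real.norm_eq_abs, abs_mul, abs_mul]
    exact mul_le_mul (mul_le_mul (hup x) (hhb' _) (abs_nonneg _) h2) h1 (abs_nonneg _)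
      (mul_nonneg h2 hH'0)
  have hCi : ∀ᶠ n in atTop, Integrable
      (fun x ↦ |u x| ^ p * h' (rn n x) * (γ x ^ (p - 2) * (k n x - γ x ^ 2))) ν := by
    filter_upwards [hlim.eventually (gt_mem_nhds one_pos)] with n hn
    have hei : Integrable (fun x ↦ e n x ^ p) ν := by
      refine ⟨((he n).pow_const _).aestronglyMeasurable, ?_⟩
      refine (lintegral_congr fun x ↦ ?_).trans_lt (hn.trans ENNReal.one_lt_top)
      rw [Real.enorm_of_nonneg (Real.rpow_nonneg (he0 n x) _), Real.enorm_of_nonneg (he0 n x),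
        ENNReal.ofReal_rpow_of_nonneg (he0 n x) hp0.le]
    exact ((integrable_rpow_sub_one_mul hp hγ0 (he0 n) hγ (he n) hγi hei).const_mul _).mono'
      (hCm n) (.of_forall (hCb n))
  have hlimC : Tendsto (fun n ↦ ∫ x, |u x| ^ p * h' (rn n x) *
      (γ x ^ (p - 2) * (k n x - γ x ^ 2)) ∂ν) atTop (𝓝 (∫ _, (0 : ℝ) ∂ν)) := by
    refine tendsto_integral_of_L1 _ aestronglyMeasurable_const hCi ?_
    have h1 := ENNReal.Tendsto.const_mul (a := ENNReal.ofReal (m ^ p * H'))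
      (tendsto_lintegral_rpow_sub_one_mul hp hγ0 hγ he hγi hlim) (.inr ENNReal.ofReal_ne_top)
    rw [mul_zero] at h1
    refine tendsto_of_tendsto_of_tendsto_of_le_of_le tendsto_const_nhds h1 (fun _ ↦ zero_le)
      fun n ↦ ?_
    simp only
    rw [← lintegral_const_mul' _ _ ENNReal.ofReal_ne_top]
    refine lintegral_mono fun x ↦ ?_
    have h2 := (abs_nonneg _).trans (hup x)
    rw [sub_zero, ← enorm_mul, ← ofReal_norm, ← ofReal_norm,
      ← ENNReal.ofReal_mul (mul_nonneg h2 hH'0)]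
    refine ENNReal.ofReal_le_ofReal ((hCb n x).trans ?_)
    exact mul_le_mul_of_nonneg_left (Real.le_norm_self _) (mul_nonneg h2 hH'0)
  have hsum := (hlimA.add hlimB).add hlimC
  rw [integral_zero, add_zero, ← integral_add (hAi r hr) (hBi r hr)] at hsum
  have hABi (s : α → ℝ) (hs : AEMeasurable s ν) : Integrable
      (fun x ↦ γ x ^ (p - 2) * b x * (p * |u x| ^ (p - 2) * u x) * h (s x) +
        γ x ^ p * |u x| ^ p * h' (s x)) ν := (hAi s hs).add (hBi s hs)
  refine ⟨hABi r hr, ge_of_tendsto hsum ?_⟩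
  filter_upwards [hCi] with n hn
  rw [← integral_add (hAi _ (hrn n)) (hBi _ (hrn n)),
    ← integral_add (hABi _ (hrn n)) hn]
  refine (hnn n).trans_eq (integral_congr_ae (.of_forall fun x ↦ ?_))
  have hγp : γ x ^ p = γ x ^ (p - 2) * γ x ^ 2 := by
    rw [← rpow_sub_one_mul_self (hγ0 x) hp, ← rpow_sub_two_mul_self (hγ0 x) hp]; ring
  simp only [hγp]
  ring

/-- Hölder's inequality turns the limit inequality into a Hardy inequality. -/
theorem integral_rpow_le_of_nonneg (hp : 1 < p) (hε : 0 < ε) {γ β b u r : α → ℝ}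
    (hγ0 : ∀ x, 0 ≤ γ x) (hβ0 : ∀ x, 0 ≤ β x)
    (hγ : AEMeasurable γ ν) (hβ : AEMeasurable β ν)
    (hu : AEMeasurable u ν) (hr : AEMeasurable r ν) (hr0 : ∀ᵐ x ∂ν, 0 ≤ r x)
    (hbβ : ∀ x, |b x| ≤ γ x * β x) {m : ℝ} (hm : ∀ x, |u x| ≤ m)
    (hγi : Integrable (fun x ↦ γ x ^ p) ν) (hβi : Integrable (fun x ↦ β x ^ p) ν)
    (hint : Integrable (fun x ↦ γ x ^ (p - 2) * b x * (p * |u x| ^ (p - 2) * u x) *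
      negPowCut p ε (r x) + γ x ^ p * |u x| ^ p * ((1 - p) * (|r x| + ε) ^ (-p))) ν)
    (hnn : 0 ≤ ∫ x, γ x ^ (p - 2) * b x * (p * |u x| ^ (p - 2) * u x) * negPowCut p ε (r x) +
      γ x ^ p * |u x| ^ p * ((1 - p) * (|r x| + ε) ^ (-p)) ∂ν) :
    ∫⁻ x, ENNReal.ofReal ((|u x| * (γ x / (|r x| + ε))) ^ p) ∂ν ≤
      ENNReal.ofReal ((p / (p - 1)) ^ p) * ∫⁻ x, ENNReal.ofReal (β x ^ p) ∂ν := by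
  have hp0 : 0 < p := by linarith
  set X : α → ℝ := fun x ↦ |u x| * (γ x / (|r x| + ε)) with hX
  have hre (x : α) : 0 < |r x| + ε := by positivity
  have hX0 (x : α) : 0 ≤ X x := mul_nonneg (abs_nonneg _) (div_nonneg (hγ0 x) (hre x).le)
  have hXm : AEMeasurable X ν := hu.abs.mul (hγ.div (hr.abs.add_const ε))
  have hXle (x : α) : X x ≤ m / ε * γ x := by
    have : X x ≤ m * (γ x / ε) := by
      refine mul_le_mul (hm x) ?_ (div_nonneg (hγ0 x) (hre x).le) ((abs_nonneg _).trans (hm x))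
      exact div_le_div_of_nonneg_left (hγ0 x) hε (by linarith [abs_nonneg (r x)])
    refine this.trans_eq (by ring)
  -- The finiteness that permits absorption: ε > 0 and the boundedness of `u` give X ≤ (m/ε) γ.
  have hXi : Integrable (fun x ↦ X x ^ p) ν := by
    refine (hγi.const_mul ((m / ε) ^ p)).mono' (hXm.pow_const _).aestronglyMeasurable
      (.of_forall fun x ↦ ?_)
    rw [Real.norm_of_nonneg (Real.rpow_nonneg (hX0 x) _), ← Real.mul_rpow
      (div_nonneg ((abs_nonneg _).trans (hm x)) hε.le) (hγ0 x)]
    exact Real.rpow_le_rpow (hX0 x) (hXle x) hp0.le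
  have hXβ := integrable_rpow_sub_one_mul hp hX0 hβ0 hXm hβ hXi hβi
  have hpt : ∀ᵐ x ∂ν, γ x ^ (p - 2) * b x * (p * |u x| ^ (p - 2) * u x) * negPowCut p ε (r x) +
      γ x ^ p * |u x| ^ p * ((1 - p) * (|r x| + ε) ^ (-p)) ≤
      p * (X x ^ (p - 1) * β x) - (p - 1) * X x ^ p := by
    filter_upwards [hr0] with x hx
    -- The limit `r` is nonnegative, unlike its approximants, so here the cutoff is the true power.
    have hcut : negPowCut p ε (r x) = (|r x| + ε) ^ (1 - p) := by
      rw [negPowCut, if_pos hx, abs_of_nonneg hx]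
    have hXp (s : ℝ) : X x ^ s = |u x| ^ s * (γ x ^ s * (|r x| + ε) ^ (-s)) := by
      rw [hX, Real.mul_rpow (abs_nonneg _) (div_nonneg (hγ0 x) (hre x).le),
        Real.div_rpow (hγ0 x) (hre x).le, Real.rpow_neg (hre x).le, div_eq_mul_inv]
    have h1 : γ x ^ (p - 2) * b x * (p * |u x| ^ (p - 2) * u x) * negPowCut p ε (r x) ≤
        p * (X x ^ (p - 1) * β x) := by
      refine (le_abs_self _).trans ?_
      rw [hcut, abs_mul, abs_mul, abs_mul, abs_mul (p * _), abs_mul p, abs_of_pos hp0,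
        abs_of_nonneg (Real.rpow_nonneg (hγ0 x) _),
        abs_of_nonneg (Real.rpow_nonneg (abs_nonneg (u x)) _),
        abs_of_nonneg (Real.rpow_nonneg (hre x).le _), mul_assoc p,
        rpow_sub_two_mul_self (abs_nonneg _) hp, hXp, ← rpow_sub_two_mul_self (hγ0 x) hp, neg_sub]
      have h2 := mul_le_mul_of_nonneg_left (hbβ x) (Real.rpow_nonneg (hγ0 x) (p - 2))
      have h3 : 0 ≤ p * |u x| ^ (p - 1) * (|r x| + ε) ^ (1 - p) := by
        have := hre x
        positivity
      nlinarith [mul_le_mul_of_nonneg_right h2 h3]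
    rw [hXp p]
    linarith
  have hle : (p - 1) * ∫ x, X x ^ p ∂ν ≤ p * ∫ x, X x ^ (p - 1) * β x ∂ν := by
    have hi1 := hXβ.const_mul p
    have hi2 := hXi.const_mul (p - 1)
    have h1 : 0 ≤ ∫ x, (p * (X x ^ (p - 1) * β x) - (p - 1) * X x ^ p) ∂ν := by
      exact hnn.trans (integral_mono_ae hint (hi1.sub hi2) hpt)
    rw [integral_sub hi1 hi2, integral_const_mul, integral_const_mul] at h1
    linarith
  have hHolder : ∫ x, X x ^ (p - 1) * β x ∂ν ≤
      (∫ x, X x ^ p ∂ν) ^ (1 - 1 / p) * (∫ x, β x ^ p ∂ν) ^ (1 / p) := by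
    have hpq : (p / (p - 1)).HolderConjugate p := (Real.HolderConjugate.conjExponent hp).symm
    have hXq (x : α) : (X x ^ (p - 1)) ^ (p / (p - 1)) = X x ^ p := by
      rw [← Real.rpow_mul (hX0 x), mul_div_cancel₀ _ (by linarith)]
    have h1 : MemLp (fun x ↦ X x ^ (p - 1)) (ENNReal.ofReal (p / (p - 1))) ν := by
      rw [← integrable_norm_rpow_iff (hXm.pow_const _).aestronglyMeasurable
        (by simpa using hpq.pos) ENNReal.ofReal_ne_top, ENNReal.toReal_ofReal hpq.pos.le]
      refine hXi.congr (.of_forall fun x ↦ ?_)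
      simp only [Real.norm_of_nonneg (Real.rpow_nonneg (hX0 x) (p - 1)), hXq]
    have h2 : MemLp β (ENNReal.ofReal p) ν := by
      rw [← integrable_norm_rpow_iff hβ.aestronglyMeasurable
        (by simpa using hp0) ENNReal.ofReal_ne_top, ENNReal.toReal_ofReal hp0.le]
      refine hβi.congr (.of_forall fun x ↦ ?_)
      simp only [Real.norm_of_nonneg (hβ0 x)]
    have h3 := integral_mul_le_Lp_mul_Lq_of_nonneg hpq
      (.of_forall fun x ↦ Real.rpow_nonneg (hX0 x) _) (.of_forall hβ0) h1 h2
    simp only [hXq] at h3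
    rwa [show 1 / (p / (p - 1)) = 1 - 1 / p by
      have : p - 1 ≠ 0 := by linarith
      field_simp] at h3
  have hI : 0 ≤ ∫ x, X x ^ p ∂ν := integral_nonneg fun x ↦ Real.rpow_nonneg (hX0 x) _
  have hJ : 0 ≤ ∫ x, β x ^ p ∂ν := integral_nonneg fun x ↦ Real.rpow_nonneg (hβ0 x) _
  have hfin := le_rpow_mul_of_mul_le hp hI hJ
    (hle.trans (mul_le_mul_of_nonneg_left hHolder hp0.le))
  rw [← ofReal_integral_eq_lintegral_ofReal hXi (.of_forall fun x ↦ Real.rpow_nonneg (hX0 x) _),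
    ← ofReal_integral_eq_lintegral_ofReal hβi (.of_forall fun x ↦ Real.rpow_nonneg (hβ0 x) _),
    ← ENNReal.ofReal_mul (Real.rpow_nonneg (div_nonneg hp0.le (by linarith)) _)]
  exact ENNReal.ofReal_le_ofReal hfin

end Integrals

/-! ### The Hardy inequality for p-superharmonic functions. -/

section Hardy

variable {N : ℕ} {M : Type*} [TopologicalSpace M] [SecondCountableTopology M]
  [ChartedSpace (𝔼 N) M] [IsManifold (𝓡 N) ∞ M] [MeasurableSpace M] [BorelSpace M]
  [RiemannianBundle (fun x : M ↦ TangentSpace (𝓡 N) x)]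
  [IsContMDiffRiemannianBundle (𝓡 N) ∞ (𝔼 N) (fun x : M ↦ TangentSpace (𝓡 N) x)]

/-- |·|^p is C¹ since p > 1, and the behaviour of `ψ` off `U` is irrelevant because the factor |u|^p
vanishes near every point outside the support of `u`. -/
theorem isC1Compact_abs_rpow_mul {p : ℝ} (hp : 1 < p) {Ω U : Set M} (hU : IsOpen U) {u ψ : M → ℝ}
    (hu : IsC1Compact N Ω u) (huU : tsupport u ⊆ U) (hψ : ContMDiffOn (𝓡 N) 𝓘(ℝ, ℝ) 1 ψ U)
    {h : ℝ → ℝ} (hh : ContDiff ℝ 1 h) :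
    IsC1Compact N Ω (fun x ↦ |u x| ^ p * h (ψ x)) := by
  have hzero : ∀ x ∉ tsupport u, (fun x ↦ |u x| ^ p * h (ψ x)) =ᶠ[𝓝 x] fun _ ↦ 0 := fun x hx ↦ by
    filter_upwards [notMem_tsupport_iff_eventuallyEq.1 hx] with z hz
    rw [hz, Pi.zero_apply, abs_zero, Real.zero_rpow (by linarith), zero_mul]
  have hsub : tsupport (fun x ↦ |u x| ^ p * h (ψ x)) ⊆ tsupport u := fun x hx ↦ by
    by_contra hxu
    exact notMem_tsupport_iff_eventuallyEq.2 (hzero x hxu) hx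
  refine ⟨fun x ↦ ?_, hu.hasCompactSupport.of_isClosed_subset (isClosed_tsupport _) hsub,
    hsub.trans hu.tsupport_subset⟩
  by_cases hx : x ∈ tsupport u
  · have h1 : ContMDiffAt (𝓡 N) 𝓘(ℝ, ℝ) 1 (fun x ↦ |u x| ^ p) x :=
      ((contDiff_norm_rpow (E := ℝ) hp).contDiffAt.contMDiffAt).comp x (hu.contMDiff x)
    have h2 : ContMDiffAt (𝓡 N) 𝓘(ℝ, ℝ) 1 (fun x ↦ h (ψ x)) x :=
      (hh.contDiffAt.contMDiffAt).comp x ((hψ x (huU hx)).contMDiffAt (hU.mem_nhds (huU hx)))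
    exact h1.mul h2
  · exact contMDiffAt_const.congr_of_eventuallyEq (hzero x hx)

theorem HasDerivAt.mfderiv_comp_apply {f : M → ℝ} {h : ℝ → ℝ} {h' : ℝ} {x : M}
    (hh : HasDerivAt h h' (f x)) (hf : MDifferentiableAt (𝓡 N) 𝓘(ℝ, ℝ) f x) :
    HasMFDerivAt (𝓡 N) 𝓘(ℝ, ℝ) (fun x ↦ h (f x)) x (h' • mfderiv (𝓡 N) 𝓘(ℝ, ℝ) f x) := by
  have h1 := hh.hasFDerivAt.hasMFDerivAt.comp x hf.hasMFDerivAt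
  refine h1.congr_mfderiv ?_
  ext v
  exact mul_comm (G := ℝ) _ _

theorem inner_grad_abs_rpow_mul {p : ℝ} (hp : 1 < p) {u ψ : M → ℝ} {x : M}
    (hu : MDifferentiableAt (𝓡 N) 𝓘(ℝ, ℝ) u x) (hψ : MDifferentiableAt (𝓡 N) 𝓘(ℝ, ℝ) ψ x)
    {h : ℝ → ℝ} {h' : ℝ} (hh : HasDerivAt h h' (ψ x)) (v : TangentSpace (𝓡 N) x) :
    inner ℝ v (grad (N := N) (fun x ↦ |u x| ^ p * h (ψ x)) x) =
      p * |u x| ^ (p - 2) * u x * h (ψ x) * inner ℝ v (grad (N := N) u x) +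
        |u x| ^ p * h' * inner ℝ v (grad (N := N) ψ x) := by
  have h1 := HasDerivAt.mfderiv_comp_apply (hasDerivAt_abs_rpow (u x) hp) hu
  have h2 := HasDerivAt.mfderiv_comp_apply hh hψ
  have h3 := (h1.mul h2).mfderiv
  rw [real_inner_comm, real_inner_comm (grad (N := N) u x), real_inner_comm (grad (N := N) ψ x),
    inner_grad, inner_grad, inner_grad]
  have h4 (A B : ℝ) : |u x| ^ p * (h' * A) + h (ψ x) * ((p * |u x| ^ (p - 2) * u x) * B) =
      p * |u x| ^ (p - 2) * u x * h (ψ x) * B + |u x| ^ p * h' * A := by ring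
  exact (DFunLike.congr_fun h3 v).trans
    (h4 (mfderiv (𝓡 N) 𝓘(ℝ, ℝ) ψ x v) (mfderiv (𝓡 N) 𝓘(ℝ, ℝ) u x v))

/-- Compare with one approximant, whose gradient is in L^q, at finite distance from `G`. -/
theorem HasSobolevGradOn.lintegral_grad_lt_top {q : ℝ} (hq : 1 ≤ q) {U : Set M} (hU : IsOpen U)
    {f : M → ℝ} {G : ∀ x : M, TangentSpace (𝓡 N) x} (hf : HasSobolevGradOn q U f G) :
    ∫⁻ x in U, ‖G x‖ₑ ^ q ∂riemannianVolume N M < ⊤ := by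
  obtain ⟨φ, hφ, -, hφG⟩ := hf.exists_approx
  obtain ⟨n, hn⟩ := (hφG.eventually (gt_mem_nhds one_pos)).exists
  have hm := aemeasurableField_grad hU ((hφ n).1.of_le (by exact_mod_cast le_top))
  have hle (x : M) : ‖G x‖ₑ ^ q ≤ 2 ^ (q - 1) *
      (‖grad (N := N) (φ n) x‖ₑ ^ q + ‖grad (N := N) (φ n) x - G x‖ₑ ^ q) := by
    refine (ENNReal.rpow_le_rpow ?_ (by linarith)).trans
      (ENNReal.rpow_add_le_mul_rpow_add_rpow _ _ hq)
    calc ‖G x‖ₑ = ‖grad (N := N) (φ n) x - (grad (N := N) (φ n) x - G x)‖ₑ := by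
          rw [sub_sub_cancel]
      _ ≤ _ := enorm_sub_le
  refine (lintegral_mono hle).trans_lt ?_
  rw [lintegral_const_mul' _ _ (ENNReal.rpow_ne_top_of_nonneg (by linarith) (by simp)),
    lintegral_add_left' ((hm.enorm hU).pow_const _)]
  exact ENNReal.mul_lt_top (ENNReal.rpow_lt_top_of_nonneg (by linarith) (by simp))
    (ENNReal.add_lt_top.2 ⟨(hφ n).2.2, hn.trans ENNReal.one_lt_top⟩)

variable {p : ℝ} {Ω U : Set M} {ρ : M → ℝ} {G : ∀ x : M, TangentSpace (𝓡 N) x} {u : M → ℝ}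

theorem IsPSuperharmonic.lintegral_rpow_add_le (hp : 1 < p) (hΩ : IsOpen Ω) (hU : IsOpen U)
    (hUΩ : U ⊆ Ω) (hρ : HasSobolevGradOn p U ρ G)
    (hρ0 : ∀ᵐ x ∂(riemannianVolume N M).restrict U, 0 ≤ ρ x)
    (hsuper : IsPSuperharmonic p Ω ρ G) (hu : IsC1Compact N Ω u) (huU : tsupport u ⊆ U)
    (hB : ∫⁻ x in U, ‖grad (N := N) u x‖ₑ ^ p ∂riemannianVolume N M ≠ ⊤) {ε : ℝ} (hε : 0 < ε) :
    ∫⁻ x in U, (‖u x‖ₑ * (‖G x‖ₑ / (ENNReal.ofReal (ρ x) + ENNReal.ofReal ε))) ^ p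
        ∂riemannianVolume N M ≤
      ENNReal.ofReal ((p / (p - 1)) ^ p) *
        ∫⁻ x in U, ‖grad (N := N) u x‖ₑ ^ p ∂riemannianVolume N M := by
  have hp0 : 0 < p := by linarith
  obtain ⟨φ, hφ, hφρ, hφG⟩ := hρ.exists_approx
  have hφ1 (n : ℕ) : ContMDiffOn (𝓡 N) 𝓘(ℝ, ℝ) 1 (φ n) U :=
    (hφ n).1.of_le (by exact_mod_cast le_top)
  have hφm (n : ℕ) : AEMeasurable (φ n) ((riemannianVolume N M).restrict U) :=
    (hφ1 n).continuousOn.aemeasurable hU.measurableSet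
  obtain ⟨ns, hns, hae⟩ := exists_subseq_tendsto_ae_of_lintegral_rpow hφm hρ.aemeasurable hp0 hφρ
  obtain ⟨m, hm⟩ :=
    hu.contMDiff.continuous.bounded_above_of_compact_support hu.hasCompactSupport
  have hGf := hρ.aemeasurable_grad
  have hgu : AEMeasurableField U (grad (N := N) u) :=
    aemeasurableField_grad hU hu.contMDiff.contMDiffOn
  have hgφ (n : ℕ) : AEMeasurableField U (grad (N := N) (φ n)) :=
    aemeasurableField_grad hU (hφ1 n)
  have hum : AEMeasurable u ((riemannianVolume N M).restrict U) :=
    hu.contMDiff.continuous.measurable.aemeasurable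
  have henorm (F : ∀ x : M, TangentSpace (𝓡 N) x) (x : M) :
      ENNReal.ofReal (‖F x‖ ^ p) = ‖F x‖ₑ ^ p := by
    rw [← ofReal_norm, ENNReal.ofReal_rpow_of_nonneg (norm_nonneg _) hp0.le]
  have hint {F : ∀ x : M, TangentSpace (𝓡 N) x} (hF : AEMeasurableField U F)
      (h : ∫⁻ x in U, ‖F x‖ₑ ^ p ∂riemannianVolume N M ≠ ⊤) :
      Integrable (fun x ↦ ‖F x‖ ^ p) ((riemannianVolume N M).restrict U) := by
    refine ⟨((hF.norm hU).pow_const _).aestronglyMeasurable, lt_of_eq_of_lt ?_ h.lt_top⟩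
    refine lintegral_congr fun x ↦ ?_
    rw [Real.enorm_of_nonneg (Real.rpow_nonneg (norm_nonneg _) _), henorm]
  have hGi := hint hGf (hρ.lintegral_grad_lt_top hp.le hU).ne
  have hui := hint hgu hB
  have hnn (n : ℕ) : 0 ≤ ∫ x in U, ‖G x‖ ^ (p - 2) *
      (p * |u x| ^ (p - 2) * u x * negPowCut p ε (φ n x) * inner ℝ (G x) (grad (N := N) u x) +
        |u x| ^ p * ((1 - p) * (|φ n x| + ε) ^ (-p)) * inner ℝ (G x) (grad (N := N) (φ n) x))
        ∂riemannianVolume N M := by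
    have hC1 := isC1Compact_abs_rpow_mul hp hU hu huU (hφ1 n) (contDiff_negPowCut (p := p) hε)
    have h1 := hsuper.integral_nonneg _ hC1 fun x ↦
      mul_nonneg (Real.rpow_nonneg (abs_nonneg _) _) (negPowCut_nonneg hp hε _)
    have hout : ∀ x ∈ Ω \ U, ‖G x‖ ^ (p - 2) * inner ℝ (G x)
        (grad (N := N) (fun x ↦ |u x| ^ p * negPowCut p ε (φ n x)) x) = 0 := by
      intro x hx
      have hxu : x ∉ tsupport u := fun h ↦ hx.2 (huU h)
      have hz : (fun x ↦ |u x| ^ p * negPowCut p ε (φ n x)) =ᶠ[𝓝 x] fun _ ↦ 0 := by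
        filter_upwards [notMem_tsupport_iff_eventuallyEq.1 hxu] with z hz
        rw [hz, Pi.zero_apply, abs_zero, Real.zero_rpow hp0.ne', zero_mul]
      rw [real_inner_comm, inner_grad, hz.mfderiv_eq, mfderiv_const]
      exact mul_zero _
    refine h1.trans_eq ((setIntegral_eq_of_subset_of_forall_sdiff_eq_zero hΩ.measurableSet hUΩ
      hout).trans (setIntegral_congr_fun hU.measurableSet fun x hx ↦ ?_))
    rw [inner_grad_abs_rpow_mul hp (hu.contMDiff.mdifferentiableAt one_ne_zero)
      (((hφ1 n x hx).contMDiffAt (hU.mem_nhds hx)).mdifferentiableAt one_ne_zero)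
      (hasDerivAt_negPowCut hε _)]
  obtain ⟨hi, h0⟩ := integral_limit_nonneg hp hε (γ := fun x ↦ ‖G x‖)
    (β := fun x ↦ ‖grad (N := N) u x‖) (b := fun x ↦ inner ℝ (G x) (grad (N := N) u x))
    (rn := fun n ↦ φ (ns n)) (k := fun n x ↦ inner ℝ (G x) (grad (N := N) (φ (ns n)) x))
    (e := fun n x ↦ ‖grad (N := N) (φ (ns n)) x - G x‖)
    (fun _ ↦ norm_nonneg _) (fun _ ↦ norm_nonneg _) (fun _ _ ↦ norm_nonneg _)
    (hGf.norm hU) (hgu.norm hU) (hGf.inner hU hgu) hum hρ.aemeasurable (fun n ↦ hφm (ns n))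
    (fun n ↦ hGf.inner hU (hgφ (ns n))) (fun n ↦ ((hgφ (ns n)).sub hGf).norm hU)
    (fun x ↦ abs_real_inner_le_norm _ _)
    (fun n x ↦ by
      rw [← real_inner_self_eq_norm_sq, ← inner_sub_right]
      exact abs_real_inner_le_norm _ _)
    hm hGi hui (by simpa [Function.comp_def] using hφG.comp hns.tendsto_atTop) hae (fun n ↦ hnn (ns n))
  have hfin := integral_rpow_le_of_nonneg hp hε (fun _ ↦ norm_nonneg _) (fun _ ↦ norm_nonneg _)
    (hGf.norm hU) (hgu.norm hU) hum hρ.aemeasurable hρ0 (fun x ↦ abs_real_inner_le_norm _ _)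
    hm hGi hui hi h0
  simp only [henorm] at hfin
  refine le_of_eq_of_le (lintegral_congr_ae ?_) hfin
  filter_upwards [hρ0] with x hx
  rw [← ENNReal.ofReal_rpow_of_nonneg (by positivity) hp0.le, ENNReal.ofReal_mul (abs_nonneg _),
    ENNReal.ofReal_div_of_pos (by positivity), abs_of_nonneg hx, ENNReal.ofReal_add hx hε.le,
    ofReal_norm, ← Real.norm_eq_abs, ofReal_norm]

/-- The Hardy inequality of a nonnegative `p`-superharmonic function. -/
theorem IsPSuperharmonic.lintegral_hardy (hp : 1 < p) (hΩ : IsOpen Ω) (hU : IsOpen U)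
    (hUΩ : U ⊆ Ω) (hρ : HasSobolevGradOn p U ρ G)
    (hρ0 : ∀ᵐ x ∂(riemannianVolume N M).restrict U, 0 ≤ ρ x)
    (hsuper : IsPSuperharmonic p Ω ρ G) (hu : IsC1Compact N Ω u) (huU : tsupport u ⊆ U) :
    ∫⁻ x in U, (‖u x‖ₑ * (‖G x‖ₑ / ENNReal.ofReal (ρ x))) ^ p ∂riemannianVolume N M ≤
      ENNReal.ofReal ((p / (p - 1)) ^ p) *
        ∫⁻ x in U, ‖grad (N := N) u x‖ₑ ^ p ∂riemannianVolume N M := by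
  have hp0 : 0 < p := by linarith
  have hC : 0 < (p / (p - 1)) ^ p := Real.rpow_pos_of_pos (div_pos hp0 (by linarith)) _
  -- Infinite energy is trivial as the constant is positive; otherwise all integrals for fixed ε are
  -- finite.
  by_cases hB : ∫⁻ x in U, ‖grad (N := N) u x‖ₑ ^ p ∂riemannianVolume N M = ⊤
  · rw [hB, ENNReal.mul_top (by simpa using hC)]
    exact le_top
  have hbound (n : ℕ) := hsuper.lintegral_rpow_add_le hp hΩ hU hUΩ hρ hρ0 hu huU hB
    (ε := 1 / (n + 1 : ℝ)) (by positivity)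
  have hm (n : ℕ) : AEMeasurable (fun x ↦ (‖u x‖ₑ * (‖G x‖ₑ /
      (ENNReal.ofReal (ρ x) + ENNReal.ofReal (1 / (n + 1 : ℝ))))) ^ p)
      ((riemannianVolume N M).restrict U) :=
    (hu.contMDiff.continuous.measurable.aemeasurable.enorm.mul
      ((hρ.aemeasurable_grad.enorm hU).div
        (hρ.aemeasurable.ennreal_ofReal.add_const _))).pow_const _
  -- This holds also where ρ = 0: inversion is continuous on [0, ∞] with 0⁻¹ = ∞, and the fixed
  -- factors are finite. Where moreover ∇ρ = 0, all terms are 0.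
  have hlim (x : M) : Tendsto (fun n : ℕ ↦ (‖u x‖ₑ * (‖G x‖ₑ /
      (ENNReal.ofReal (ρ x) + ENNReal.ofReal (1 / (n + 1 : ℝ))))) ^ p) atTop
      (𝓝 ((‖u x‖ₑ * (‖G x‖ₑ / ENNReal.ofReal (ρ x))) ^ p)) := by
    have h1 : Tendsto (fun n : ℕ ↦ ENNReal.ofReal (ρ x) + ENNReal.ofReal (1 / (n + 1 : ℝ))) atTop
        (𝓝 (ENNReal.ofReal (ρ x) + ENNReal.ofReal 0)) :=
      tendsto_const_nhds.add
        (ENNReal.tendsto_ofReal (tendsto_one_div_add_atTop_nhds_zero_nat (𝕜 := ℝ)))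
    rw [ENNReal.ofReal_zero, add_zero] at h1
    simp only [div_eq_mul_inv] at h1 ⊢
    exact (ENNReal.Tendsto.const_mul (ENNReal.Tendsto.const_mul (tendsto_inv_iff.2 h1)
      (.inr enorm_ne_top)) (.inr enorm_ne_top)).ennrpow_const p
  calc ∫⁻ x in U, (‖u x‖ₑ * (‖G x‖ₑ / ENNReal.ofReal (ρ x))) ^ p ∂riemannianVolume N M
      = ∫⁻ x in U, liminf (fun n : ℕ ↦ (‖u x‖ₑ * (‖G x‖ₑ /
          (ENNReal.ofReal (ρ x) + ENNReal.ofReal (1 / (n + 1 : ℝ))))) ^ p) atTop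
          ∂riemannianVolume N M := lintegral_congr fun x ↦ (hlim x).liminf_eq.symm
    _ ≤ liminf (fun n : ℕ ↦ ∫⁻ x in U, (‖u x‖ₑ * (‖G x‖ₑ /
          (ENNReal.ofReal (ρ x) + ENNReal.ofReal (1 / (n + 1 : ℝ))))) ^ p
          ∂riemannianVolume N M) atTop := lintegral_liminf_le' hm
    _ ≤ _ := liminf_le_of_le (by isBoundedDefault) fun b hb ↦ by
      obtain ⟨n, hn⟩ := hb.exists
      exact hn.trans (hbound n)

end Hardy

/-! ### Interpolation by Hölder's inequality. -/

section Holder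

/-- Hölder's inequality for `v ^ s = (v * w) ^ (p / a) * (v ^ (s - p / a) * w⁻¹ ^ (p / a))`. -/
theorem lintegral_rpow_le_of_weighted {α : Type*} [MeasurableSpace α] {ν : Measure α}
    {v w : α → ℝ≥0∞} (hv : AEMeasurable v ν) (hw : AEMeasurable w ν)
    (hv0 : ∀ᵐ x ∂ν, v x ≠ 0) (hvt : ∀ᵐ x ∂ν, v x ≠ ⊤) (hwt : ∀ᵐ x ∂ν, w x ≠ ⊤)
    {p s a a' C : ℝ} (hp : 0 < p) (ha : a.HolderConjugate a') (hC : 0 < C) {B : ℝ≥0∞}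
    (hB : ∫⁻ x, (v x * w x) ^ p ∂ν ≤ ENNReal.ofReal (C ^ p) * B)
    (hne : B ≠ 0 ∨
      ∫⁻ x, v x ^ ((a * s - p) / (a - 1)) * (w x)⁻¹ ^ (p * (a' - 1)) ∂ν ≠ ⊤) :
    ∫⁻ x, v x ^ s ∂ν ≤ ENNReal.ofReal (C ^ (p / a)) * B ^ (1 / a) *
      (∫⁻ x, v x ^ ((a * s - p) / (a - 1)) * (w x)⁻¹ ^ (p * (a' - 1)) ∂ν) ^ (1 / a') := by
  have ha0 := ha.pos
  have ha'0 := ha.symm.pos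
  have ha1 := ha.lt
  have ha'1 := ha.symm.lt
  have hexp : 0 < p * (a' - 1) := mul_pos hp (by linarith)
  set Q := ∫⁻ x, v x ^ ((a * s - p) / (a - 1)) * (w x)⁻¹ ^ (p * (a' - 1)) ∂ν with hQ
  by_cases hQt : Q = ⊤
  · have hB0 : B ≠ 0 := hne.resolve_right (not_not.2 hQt)
    rw [hQt, ENNReal.top_rpow_of_pos (by positivity), ENNReal.mul_top]
    · exact le_top
    · refine mul_ne_zero (by simpa using Real.rpow_pos_of_pos hC _) ?_
      rw [Ne, ENNReal.rpow_eq_zero_iff]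
      rintro (h | h)
      · exact hB0 h.1
      · have : 0 < 1 / a := by positivity
        linarith [h.2]
  -- Where w = 0 the integrand of `Q` is ∞, so finiteness of `Q` makes {w = 0} null and w · w⁻¹ = 1
  -- a.e.
  have hw0 : ∀ᵐ x ∂ν, w x ≠ 0 := by
    have hm : AEMeasurable (fun x ↦ v x ^ ((a * s - p) / (a - 1)) * (w x)⁻¹ ^ (p * (a' - 1))) ν :=
      (hv.pow_const _).mul (hw.inv.pow_const _)
    filter_upwards [ae_lt_top' hm hQt, hv0, hvt] with x hx h0 ht hwx
    rw [hwx, ENNReal.inv_zero, ENNReal.top_rpow_of_pos hexp, ENNReal.mul_top] at hx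
    · exact lt_irrefl _ hx
    · exact (ENNReal.rpow_pos (pos_iff_ne_zero.2 h0) ht).ne'
  have hsplit : ∫⁻ x, v x ^ s ∂ν =
      ∫⁻ x, ((fun x ↦ (v x * w x) ^ (p / a)) *
        (fun x ↦ v x ^ (s - p / a) * (w x)⁻¹ ^ (p / a))) x ∂ν := by
    refine lintegral_congr_ae ?_
    filter_upwards [hw0, hwt, hv0, hvt] with x hx0 hxt h0 ht
    have h1 : w x ^ (p / a) * (w x)⁻¹ ^ (p / a) = 1 := by
      rw [← ENNReal.mul_rpow_of_nonneg _ _ (by positivity), ENNReal.mul_inv_cancel hx0 hxt,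
        ENNReal.one_rpow]
    have h2 : v x ^ s = v x ^ (p / a) * v x ^ (s - p / a) := by
      rw [← ENNReal.rpow_add _ _ h0 ht]; ring_nf
    rw [Pi.mul_apply, ENNReal.mul_rpow_of_nonneg _ _ (by positivity), mul_mul_mul_comm, h1,
      mul_one, h2]
  rw [hsplit]
  refine (ENNReal.lintegral_mul_le_Lp_mul_Lq ν ha (f := fun x ↦ (v x * w x) ^ (p / a))
    (g := fun x ↦ v x ^ (s - p / a) * (w x)⁻¹ ^ (p / a)) ((hv.mul hw).pow_const _)
    ((hv.pow_const _).mul (hw.inv.pow_const _))).trans ?_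
  have e1 (x : α) : ((v x * w x) ^ (p / a)) ^ a = (v x * w x) ^ p := by
    rw [← ENNReal.rpow_mul, div_mul_cancel₀ _ ha0.ne']
  have haa : a' = a / (a - 1) := ha.conjugate_eq
  have ham : a - 1 ≠ 0 := by linarith
  -- As a' = a/(a-1), one has (s - p/a) a' = (as - p)/(a-1) and (p/a) a' = p/(a-1) = p(a'-1).
  have e2 (x : α) : (v x ^ (s - p / a) * (w x)⁻¹ ^ (p / a)) ^ a' =
      v x ^ ((a * s - p) / (a - 1)) * (w x)⁻¹ ^ (p * (a' - 1)) := by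
    rw [ENNReal.mul_rpow_of_nonneg _ _ ha'0.le, ← ENNReal.rpow_mul, ← ENNReal.rpow_mul]
    congr 2
    · rw [haa]; field_simp
    · rw [haa]; field_simp; ring
  simp only [e1, e2]
  refine mul_le_mul_left ?_ _
  refine (ENNReal.rpow_le_rpow hB (by positivity)).trans_eq ?_
  rw [ENNReal.mul_rpow_of_nonneg _ _ (by positivity), ENNReal.ofReal_rpow_of_nonneg
    (Real.rpow_nonneg hC.le _) (by positivity), ← Real.rpow_mul hC.le, mul_one_div]

end Holder

/-! ### The two inequalities of the theorem. -/

section Main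

variable {N : ℕ} {M : Type*} [TopologicalSpace M] [T2Space M] [SecondCountableTopology M]
  [ChartedSpace (𝔼 N) M] [IsManifold (𝓡 N) ∞ M] [MeasurableSpace M] [BorelSpace M]
  [RiemannianBundle (fun x : M ↦ TangentSpace (𝓡 N) x)]
  [IsContMDiffRiemannianBundle (𝓡 N) ∞ (𝔼 N) (fun x : M ↦ TangentSpace (𝓡 N) x)]
  {Ω : Set M} {ρ u : M → ℝ} {G : ∀ x : M, TangentSpace (𝓡 N) x} {p : ℝ}

theorem IsC1Compact.inter_ne_zero (hu : IsC1Compact N Ω u) :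
    Ω ∩ {x | u x ≠ 0} = {x | u x ≠ 0} :=
  inter_eq_right.2 fun _ hx ↦ hu.tsupport_subset (subset_tsupport u hx)

theorem IsC1Compact.setLIntegral_eq (hu : IsC1Compact N Ω u) {μ : Measure M}
    {f : M → ℝ≥0∞} (hf : ∀ x, u x = 0 → f x = 0) :
    ∫⁻ x in Ω, f x ∂μ = ∫⁻ x in {x | u x ≠ 0}, f x ∂μ := by
  have hT : MeasurableSet {x | u x ≠ 0} :=
    (hu.contMDiff.continuous.isOpen_preimage _ isOpen_ne).measurableSet
  have : f = {x | u x ≠ 0}.indicator f := by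
    ext x
    by_cases hx : u x = 0
    · rw [indicator_of_notMem (by simpa using hx), hf x hx]
    · rw [indicator_of_mem (show x ∈ {x | u x ≠ 0} from hx)]
  conv_lhs => rw [this]
  rw [setLIntegral_indicator hT, inter_comm, hu.inter_ne_zero]

/-- The data needed for the interpolation between the Hardy inequality and Hölder's inequality,
on the set where `u ≠ 0`. -/
theorem IsPSuperharmonic.lintegral_hardy_support (hΩ : IsOpen Ω) (hp : 1 < p)
    (hρ : HasSobolevGradLoc p Ω ρ G)
    (hρ0 : ∀ᵐ x ∂(riemannianVolume N M).restrict Ω, 0 ≤ ρ x)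
    (hsuper : IsPSuperharmonic p Ω ρ G) (hu : IsC1Compact N Ω u) :
    AEMeasurable (fun x ↦ ‖G x‖ₑ / ENNReal.ofReal (ρ x))
      ((riemannianVolume N M).restrict {x | u x ≠ 0}) ∧
    (∀ᵐ x ∂(riemannianVolume N M).restrict {x | u x ≠ 0},
      ‖G x‖ₑ / ENNReal.ofReal (ρ x) ≠ ⊤) ∧
    ∫⁻ x in {x | u x ≠ 0}, (‖u x‖ₑ * (‖G x‖ₑ / ENNReal.ofReal (ρ x))) ^ p
        ∂riemannianVolume N M ≤
      ENNReal.ofReal ((p / (p - 1)) ^ p) *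
        ∫⁻ x in Ω, ‖grad (N := N) u x‖ₑ ^ p ∂riemannianVolume N M := by
  have : LocallyCompactSpace M := Manifold.locallyCompact_of_finiteDimensional (𝓡 N)
  obtain ⟨U, hU, huU, hUΩ, hUc⟩ := exists_open_between_and_isCompact_closure
    hu.hasCompactSupport hΩ hu.tsupport_subset
  have hUΩ' : U ⊆ Ω := subset_closure.trans hUΩ
  have hTU : {x | u x ≠ 0} ⊆ U := fun x hx ↦ huU (subset_tsupport u hx)
  have hρU := hρ U hU hUc hUΩ
  refine ⟨((hρU.aemeasurable_grad.enorm hU).div hρU.aemeasurable.ennreal_ofReal).mono_measure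
    (Measure.restrict_mono hTU le_rfl), ?_, ?_⟩
  · filter_upwards [ae_mono (Measure.restrict_mono (hTU.trans hUΩ') le_rfl) hρ0,
      ae_mono (Measure.restrict_mono (hTU.trans hUΩ') le_rfl)
        (hρ.ae_eq_zero_of_eq_zero hp.le hΩ)] with x h0 hG
    -- On {ρ = 0} the gradient vanishes a.e., and the quotient 0/0 is 0 in [0, ∞].
    rcases h0.eq_or_lt with h | h
    · simp [hG h.symm]
    · exact ENNReal.div_ne_top enorm_ne_top (by simpa using h)
  · refine (lintegral_mono_set hTU).trans ((hsuper.lintegral_hardy hp hΩ hU hUΩ' hρU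
      (ae_mono (Measure.restrict_mono hUΩ' le_rfl) hρ0) hu huU).trans ?_)
    exact mul_le_mul_right (lintegral_mono_set hUΩ') _

theorem IsPSuperharmonic.lintegral_rpow_le (hΩ : IsOpen Ω) (hp : 1 < p)
    (hρ : HasSobolevGradLoc p Ω ρ G)
    (hρ0 : ∀ᵐ x ∂(riemannianVolume N M).restrict Ω, 0 ≤ ρ x)
    (hsuper : IsPSuperharmonic p Ω ρ G) {s a a' : ℝ} (hs : 0 < s) (ha : a.HolderConjugate a')
    (hu : IsC1Compact N Ω u)
    (hne : ∫⁻ x in Ω, ‖grad (N := N) u x‖ₑ ^ p ∂(riemannianVolume N M) ≠ 0 ∨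
      ∫⁻ x in Ω ∩ {x | u x ≠ 0}, ‖u x‖ₑ ^ ((a * s - p) / (a - 1)) *
        weightQuotient ρ G x ^ (p * (a' - 1)) ∂(riemannianVolume N M) ≠ ⊤) :
    ∫⁻ x in Ω, ‖u x‖ₑ ^ s ∂(riemannianVolume N M) ≤
      ENNReal.ofReal ((p / (p - 1)) ^ (p / a)) *
      (∫⁻ x in Ω, ‖grad (N := N) u x‖ₑ ^ p ∂(riemannianVolume N M)) ^ (1 / a) *
      (∫⁻ x in Ω ∩ {x | u x ≠ 0}, ‖u x‖ₑ ^ ((a * s - p) / (a - 1)) *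
        weightQuotient ρ G x ^ (p * (a' - 1)) ∂(riemannianVolume N M)) ^ (1 / a') := by
  obtain ⟨hm, hfin, hH⟩ := hsuper.lintegral_hardy_support hΩ hp hρ hρ0 hu
  have hT : MeasurableSet {x | u x ≠ 0} :=
    (hu.contMDiff.continuous.isOpen_preimage _ isOpen_ne).measurableSet
  rw [hu.inter_ne_zero] at hne ⊢
  rw [hu.setLIntegral_eq (f := fun x ↦ ‖u x‖ₑ ^ s)
    (fun x hx ↦ by simp [hx, ENNReal.zero_rpow_of_pos hs])]
  refine lintegral_rpow_le_of_weighted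
    hu.contMDiff.continuous.measurable.aemeasurable.enorm hm ?_ (.of_forall fun _ ↦ enorm_ne_top)
    hfin (by linarith) ha (div_pos (by linarith) (by linarith)) hH hne
  filter_upwards [ae_restrict_mem hT] with x hx
  exact enorm_ne_zero.2 hx

/-- Since |∇ρ|/ρ = |α|/d a.e., the weight is |α|^(-p(a'-1)) d^(p(a'-1)); the 1/a'-th power of its
constant is |α|^(-p/a), because p(a'-1)/a' = p/a. -/
theorem IsPSuperharmonic.lintegral_rpow_le_of_rpow (hΩ : IsOpen Ω) (hp : 1 < p)
    (hρ : HasSobolevGradLoc p Ω ρ G)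
    (hρ0 : ∀ᵐ x ∂(riemannianVolume N M).restrict Ω, 0 ≤ ρ x)
    (hsuper : IsPSuperharmonic p Ω ρ G) {s a a' : ℝ} (hs : 0 < s) (ha : a.HolderConjugate a')
    {α : ℝ} {d : M → ℝ} {D : ∀ x : M, TangentSpace (𝓡 N) x} (hα : α ≠ 0)
    (hd : HasSobolevGradLoc 1 Ω d D)
    (hd0 : ∀ᵐ x ∂(riemannianVolume N M).restrict Ω, 0 ≤ d x)
    (hD : ∀ᵐ x ∂(riemannianVolume N M).restrict Ω, ‖D x‖ = 1)
    (heq : ∀ᵐ x ∂(riemannianVolume N M).restrict Ω, ρ x = d x ^ α)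
    (hu : IsC1Compact N Ω u) :
    ∫⁻ x in Ω, ‖u x‖ₑ ^ s ∂(riemannianVolume N M) ≤
      ENNReal.ofReal ((p / (|α| * (p - 1))) ^ (p / a)) *
      (∫⁻ x in Ω, ‖grad (N := N) u x‖ₑ ^ p ∂(riemannianVolume N M)) ^ (1 / a) *
      (∫⁻ x in Ω ∩ {x | u x ≠ 0}, ‖u x‖ₑ ^ ((a * s - p) / (a - 1)) *
        ENNReal.ofReal (d x) ^ (p * (a' - 1)) ∂(riemannianVolume N M)) ^ (1 / a') := by
  have hp0 : 0 < p := by linarith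
  have hα' : 0 < |α| := abs_pos.2 hα
  have ha0 := ha.pos
  have ha'0 := ha.symm.pos
  have hexp : 0 < p * (a' - 1) := mul_pos hp0 (by linarith [ha.symm.lt])
  have hT : MeasurableSet {x | u x ≠ 0} :=
    (hu.contMDiff.continuous.isOpen_preimage _ isOpen_ne).measurableSet
  have hTΩ : {x | u x ≠ 0} ⊆ Ω := fun x hx ↦ hu.tsupport_subset (subset_tsupport u hx)
  have hae := ae_mono (Measure.restrict_mono hTΩ le_rfl)
    (hρ.ae_norm_div_eq_of_rpow hp.le le_rfl hΩ hd hα hd0 hD heq)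
  have hw : ∀ᵐ x ∂(riemannianVolume N M).restrict {x | u x ≠ 0},
      0 < d x ∧ ‖G x‖ₑ / ENNReal.ofReal (ρ x) = ENNReal.ofReal (|α| / d x) := by
    filter_upwards [hae] with x ⟨hdx, hρx, h⟩
    rw [← ofReal_norm, ← ENNReal.ofReal_div_of_pos hρx, h]
    exact ⟨hdx, rfl⟩
  have hQ : ∫⁻ x in Ω ∩ {x | u x ≠ 0}, ‖u x‖ₑ ^ ((a * s - p) / (a - 1)) *
      weightQuotient ρ G x ^ (p * (a' - 1)) ∂(riemannianVolume N M) =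
      ENNReal.ofReal |α|⁻¹ ^ (p * (a' - 1)) *
      ∫⁻ x in Ω ∩ {x | u x ≠ 0}, ‖u x‖ₑ ^ ((a * s - p) / (a - 1)) *
        ENNReal.ofReal (d x) ^ (p * (a' - 1)) ∂(riemannianVolume N M) := by
    rw [hu.inter_ne_zero, ← lintegral_const_mul' _ _
      (ENNReal.rpow_ne_top_of_nonneg hexp.le ENNReal.ofReal_ne_top)]
    refine lintegral_congr_ae ?_
    filter_upwards [hw] with x ⟨hdx, hx⟩
    rw [weightQuotient, hx, ← ENNReal.ofReal_inv_of_pos (div_pos hα' hdx), inv_div,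
      div_eq_inv_mul (d x), ENNReal.ofReal_mul (by positivity),
      ENNReal.mul_rpow_of_nonneg _ _ hexp.le, mul_left_comm]
  by_cases hne : ∫⁻ x in Ω, ‖grad (N := N) u x‖ₑ ^ p ∂(riemannianVolume N M) ≠ 0 ∨
      ∫⁻ x in Ω ∩ {x | u x ≠ 0}, ‖u x‖ₑ ^ ((a * s - p) / (a - 1)) *
        weightQuotient ρ G x ^ (p * (a' - 1)) ∂(riemannianVolume N M) ≠ ⊤
  · refine (hsuper.lintegral_rpow_le hΩ hp hρ hρ0 hs ha hu hne).trans_eq ?_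
    have e1 : p * (a' - 1) * (1 / a') = p / a := by
      have h1 := ha.inv_add_inv_eq_one
      have h2 : a⁻¹ = 1 - a'⁻¹ := by linarith
      rw [div_eq_mul_inv p, h2]
      field_simp
    have hpp : 0 < p / (p - 1) := div_pos hp0 (by linarith)
    have e2 : ENNReal.ofReal ((p / (|α| * (p - 1))) ^ (p / a)) =
        ENNReal.ofReal ((p / (p - 1)) ^ (p / a)) * ENNReal.ofReal |α|⁻¹ ^ (p / a) := by
      rw [ENNReal.ofReal_rpow_of_nonneg (by positivity) (by positivity),
        ← ENNReal.ofReal_mul (by positivity), ← Real.mul_rpow hpp.le (by positivity)]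
      congr 2
      have : p - 1 ≠ 0 := by linarith
      field_simp
    rw [hQ, ENNReal.mul_rpow_of_nonneg _ _ (by positivity), ← ENNReal.rpow_mul, e1, e2]
    ring
  -- The case 0·∞: zero energy makes the left side of Hardy vanish, but |u| · |α|/d > 0 a.e. on {u ≠
  -- 0}, so that set is null and the left-hand side is 0.
  · rw [not_or, not_not] at hne
    obtain ⟨hm, -, hH⟩ := hsuper.lintegral_hardy_support hΩ hp hρ hρ0 hu
    have hmH : AEMeasurable (fun x ↦ (‖u x‖ₑ * (‖G x‖ₑ / ENNReal.ofReal (ρ x))) ^ p)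
        ((riemannianVolume N M).restrict {x | u x ≠ 0}) :=
      (hu.contMDiff.continuous.measurable.aemeasurable.enorm.mul hm).pow_const _
    rw [hne.1, mul_zero, nonpos_iff_eq_zero, lintegral_eq_zero_iff' hmH] at hH
    have hfalse : ∀ᵐ x ∂(riemannianVolume N M).restrict {x | u x ≠ 0}, ‖u x‖ₑ ^ s = 0 := by
      filter_upwards [hH, hw, ae_restrict_mem hT] with x hx ⟨hdx, hwx⟩ hux
      rw [hwx, Pi.zero_apply, ENNReal.rpow_eq_zero_iff_of_pos hp0, mul_eq_zero] at hx
      rcases hx with hx | hx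
      · exact absurd hx (enorm_ne_zero.2 hux)
      · exact absurd hx (by simpa using div_pos hα' hdx)
    rw [hu.setLIntegral_eq (f := fun x ↦ ‖u x‖ₑ ^ s)
      (fun x hx ↦ by simp [hx, ENNReal.zero_rpow_of_pos hs]), lintegral_congr_ae hfalse,
      lintegral_zero]
    exact zero_le

end Main

end RiemannianHardy

theorem mainTheorem6 {N : ℕ} {M : Type*} [TopologicalSpace M] [T2Space M]
    [SecondCountableTopology M] [ChartedSpace (EuclideanSpace ℝ (Fin N)) M]
    [IsManifold (𝓡 N) ∞ M] [MeasurableSpace M] [BorelSpace M]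
    [RiemannianBundle (fun x : M ↦ TangentSpace (𝓡 N) x)]
    [IsContMDiffRiemannianBundle (𝓡 N) ∞ (EuclideanSpace ℝ (Fin N))
      (fun x : M ↦ TangentSpace (𝓡 N) x)]
    (Ω : Set M) (hΩ : IsOpen Ω) (p : ℝ) (hp : 1 < p)
    (ρ : M → ℝ) (G : ∀ x : M, TangentSpace (𝓡 N) x)
    (hρ : HasSobolevGradLoc p Ω ρ G)
    (hρ_nonneg : ∀ᵐ x ∂((riemannianVolume N M).restrict Ω), 0 ≤ ρ x)
    (hρ_super : IsPSuperharmonic p Ω ρ G)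
    (s a a' : ℝ) (hs : 0 < s) (ha : 1 < a) (ha' : 1 / a + 1 / a' = 1) :
    (∀ u : M → ℝ, IsC1Compact N Ω u →
      -- the right-hand side is not of the form `0 · ∞`
      (∫⁻ x in Ω, ‖grad (N := N) u x‖ₑ ^ p
          ∂(riemannianVolume N M) ≠ 0 ∨
        ∫⁻ x in Ω ∩ {x | u x ≠ 0}, ‖u x‖ₑ ^ ((a * s - p) / (a - 1)) *
          weightQuotient ρ G x ^ (p * (a' - 1))
          ∂(riemannianVolume N M) ≠ ⊤) →
      ∫⁻ x in Ω, ‖u x‖ₑ ^ s ∂(riemannianVolume N M) ≤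
        ENNReal.ofReal ((p / (p - 1)) ^ (p / a)) *
        (∫⁻ x in Ω, ‖grad (N := N) u x‖ₑ ^ p
          ∂(riemannianVolume N M)) ^ (1 / a) *
        (∫⁻ x in Ω ∩ {x | u x ≠ 0}, ‖u x‖ₑ ^ ((a * s - p) / (a - 1)) *
          weightQuotient ρ G x ^ (p * (a' - 1))
          ∂(riemannianVolume N M)) ^ (1 / a')) ∧
    (∀ (α : ℝ) (d : M → ℝ) (D : ∀ x : M, TangentSpace (𝓡 N) x), α ≠ 0 →
      HasSobolevGradLoc 1 Ω d D →
      (∀ᵐ x ∂((riemannianVolume N M).restrict Ω), 0 ≤ d x) →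
      (∀ᵐ x ∂((riemannianVolume N M).restrict Ω), ‖D x‖ = 1) →
      (∀ᵐ x ∂((riemannianVolume N M).restrict Ω), ρ x = d x ^ α) →
      ∀ u : M → ℝ, IsC1Compact N Ω u →
      ∫⁻ x in Ω, ‖u x‖ₑ ^ s ∂(riemannianVolume N M) ≤
        ENNReal.ofReal ((p / (|α| * (p - 1))) ^ (p / a)) *
        (∫⁻ x in Ω, ‖grad (N := N) u x‖ₑ ^ p
          ∂(riemannianVolume N M)) ^ (1 / a) *
        (∫⁻ x in Ω ∩ {x | u x ≠ 0}, ‖u x‖ₑ ^ ((a * s - p) / (a - 1)) *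
          ENNReal.ofReal (d x) ^ (p * (a' - 1))
          ∂(riemannianVolume N M)) ^ (1 / a')) := by
  have hconj : a.HolderConjugate a' := by
    rw [Real.holderConjugate_iff]
    exact ⟨ha, by simpa using ha'⟩
  exact ⟨fun u hu hne ↦ hρ_super.lintegral_rpow_le hΩ hp hρ hρ_nonneg hs hconj hu hne,
    fun α d D hα hd hd0 hD heq u hu ↦
      hρ_super.lintegral_rpow_le_of_rpow hΩ hp hρ hρ_nonneg hs hconj hα hd hd0 hD heq hu⟩
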